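/- **Setting.** Let $Z\in\mathbb R^{m\times n}$ have rank $r$, let $\hat E\subseteq\{1,\dots,m\}\times\{1,\dots,n\}$ be a set of sampled positions, viewed as the edge set of a bipartite graph on the rows and columns, and let $z=\mathcal P_{\hat E}(Z)=(Z_{ij})_{(i,j)\in\hat E}$. The low rank matrix completion problem (LRMC) asks for $M\in\mathbb R^{m\times n}$ with $\mathcal P_{\hat E}(M)=z$ and $\operatorname{rank}(M)\le r$. We say that $\hat E$ has *chain-clique (staircase) structure* if, possibly after exchanging the roles of rows and columns, there are $l\ge 1$ and bicliques $E_i=U_i\times V_i$ $(1\le i\le l)$ with nonempty row sets $U_i$ and nonempty column sets $V_i$ such that * $\bigcup_{i} E_i=\hat E$, $\bigcup_i U_i=\{1,\dots,m\}$, $\bigcup_i V_i=\{1,\dots,n\}$, and $E_i\cap E_j=\emptyset$ whenever $j\ge i+2$; * for even $i$ with $1\le i\le l-2$: $U_i\cap U_{i+2}=U_{i+1}$, $V_i\subseteq V_{i+1}$ and $V_{i+2}\subseteq V_{i+1}$; * for odd $i$ with $1\le i\le l-2$: $V_i\cap V_{i+2}=V_{i+1}$, $U_i\subseteq U_{i+1}$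 and $U_{i+2}\subseteq U_{i+1}$; * if $l=2$: $U_1\subseteq U_2$ and $V_2\subseteq V_1$; * the bicliques containing any given row, or any given column, are consecutive in the chain: $U_i\cap U_k\subseteq U_j$ and $V_i\cap V_k\subseteq V_j$ for $i\le j\le k$. **Proposition.** There is a polynomial-time algorithm which, for sampling graphs with chain-clique structure, decides whether LRMC has a unique solution. Precisely: there are one program for the real random access machine (unit-cost field operations and comparisons on real numbers with $0$ and $1$ as the only real constants; unit-cost addition, truncated subtraction and comparison on natural numbers; indexed memory) and a polynomial $p$ with natural coefficients such that, for all $m,n$, every $\hat E$ with chain-clique structure and every $Z\in\mathbb R^{m\times n}$ of rank $r$, the program, given only $m,n,r$, the adjacency matrix of $\hat E$ and the sampled entries $z=\mathcal P_{\hat E}(Z)$, halts after at most $p(m+n)$ steps, and outputs $1$ if there is exactly one $M\in\mathbb R^{m\times n}$ with $\mathcal P_{\hat E}(M)=z$ and $\operatorname{rank}(M)\le r$, and $0$ otherwise. -/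

import Mathlib

namespace LRMC

/-! ### The low rank matrix completion problem -/

/-- The projection `P_E` of a real matrix onto the entries indexed by `E`. -/
def sample {m n : ℕ} (E : Finset (Fin m × Fin n)) (M : Matrix (Fin m) (Fin n) ℝ) :
    {e : Fin m × Fin n // e ∈ E} → ℝ :=
  fun e => M e.1.1 e.1.2

/-- `M` solves the completion problem with sampled positions `E`, data `z`, target rank `r`. -/
def IsSolution {m n : ℕ} (E : Finset (Fin m × Fin n))
    (z : {e : Fin m × Fin n // e ∈ E} → ℝ) (r : ℕ) (M : Matrix (Fin m) (Fin n) ℝ) : Prop :=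
  sample E M = z ∧ M.rank ≤ r

/-! ### Chains of bicliques -/

/-- The bicliques `U i × V i`, `1 ≤ i ≤ l`, form a chain (a "staircase") whose edges are `E`.
Only the values of `U` and `V` at `1, …, l` matter. -/
structure IsBicliqueChain {m n : ℕ} (E : Finset (Fin m × Fin n)) (l : ℕ)
    (U : ℕ → Finset (Fin m)) (V : ℕ → Finset (Fin n)) : Prop where
  one_le : 1 ≤ l
  rows_nonempty : ∀ i, 1 ≤ i → i ≤ l → (U i).Nonempty
  cols_nonempty : ∀ i, 1 ≤ i → i ≤ l → (V i).Nonempty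
  /-- the union of the edge sets is `E` -/
  edges : (Finset.Icc 1 l).biUnion (fun i => U i ×ˢ V i) = E
  /-- bicliques that are not neighbours in the chain share no edge -/
  edges_disjoint : ∀ i j, 1 ≤ i → i + 2 ≤ j → j ≤ l → Disjoint (U i ×ˢ V i) (U j ×ˢ V j)
  /-- the bicliques cover all the vertices -/
  rows_cover : (Finset.Icc 1 l).biUnion U = Finset.univ
  cols_cover : (Finset.Icc 1 l).biUnion V = Finset.univ
  even_step : ∀ i, 1 ≤ i → i + 2 ≤ l → Even i →
    U i ∩ U (i + 2) = U (i + 1) ∧ V i ∩ V (i + 1) = V i ∧ V (i + 2) ∩ V (i + 1) = V (i + 2)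
  odd_step : ∀ i, 1 ≤ i → i + 2 ≤ l → Odd i →
    V i ∩ V (i + 2) = V (i + 1) ∧ U i ∩ U (i + 1) = U i ∧ U (i + 2) ∩ U (i + 1) = U (i + 2)
  /-- the same nesting for a chain of only two bicliques, about which `odd_step` is silent -/
  two_step : l = 2 → U 1 ∩ U 2 = U 1 ∧ V 2 ∩ V 1 = V 2
  /-- the bicliques that contain a given row, or a given column, are consecutive in the chain -/
  rows_consecutive : ∀ i j k, 1 ≤ i → i ≤ j → j ≤ k → k ≤ l → U i ∩ U k ⊆ U j
  cols_consecutive : ∀ i j k, 1 ≤ i → i ≤ j → j ≤ k → k ≤ l → V i ∩ V k ⊆ V j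

/-- The pattern `E`, or its transpose, is a chain of bicliques: the first step of the staircase
may be a horizontal or a vertical one. -/
def HasChainStructure {m n : ℕ} (E : Finset (Fin m × Fin n)) : Prop :=
  ∃ (l : ℕ) (U : ℕ → Finset (Fin m)) (V : ℕ → Finset (Fin n)),
    IsBicliqueChain E l U V ∨ IsBicliqueChain (E.image Prod.swap) l V U

/-! ### Algorithms over the real numbers

A real random access machine, programmed by structured (`while`) programs.  The memory has integer
variables, integer arrays and real arrays (each array is two-dimensional and unbounded).  On
integers there are addition, truncated subtraction and comparison only; on reals there are the
field operations and comparison, with `0` and `1` as the only constants.  There is no conversion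
between the two.  Every evaluated operation or memory access costs one step. -/

/-- The memory. -/
structure State where
  ivar : ℕ → ℕ
  iarr : ℕ → ℕ → ℕ → ℕ
  rarr : ℕ → ℕ → ℕ → ℝ

/-- Integer expressions. -/
inductive IExp where
  | lit (c : ℕ)
  | var (x : ℕ)
  | get (k : ℕ) (i j : IExp)
  | add (a b : IExp)
  | sub (a b : IExp)

/-- Real expressions. -/
inductive RExp where
  | zero
  | one
  | get (k : ℕ) (i j : IExp)
  | add (a b : RExp)
  | sub (a b : RExp)
  | mul (a b : RExp)
  | div (a b : RExp)

/-- Tests. -/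
inductive BExp where
  | ieq (a b : IExp)
  | ilt (a b : IExp)
  | req (a b : RExp)
  | rlt (a b : RExp)
  | not (a : BExp)
  | and (a b : BExp)

/-- Programs. -/
inductive Prog where
  | skip
  | setVar (x : ℕ) (a : IExp)
  | setInt (k : ℕ) (i j : IExp) (a : IExp)
  | setReal (k : ℕ) (i j : IExp) (a : RExp)
  | seq (c d : Prog)
  | ite (b : BExp) (c d : Prog)
  | while (b : BExp) (c : Prog)

namespace IExp

def eval (s : State) : IExp → ℕ
  | lit c => c
  | var x => s.ivar x
  | get k i j => s.iarr k (i.eval s) (j.eval s)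
  | add a b => a.eval s + b.eval s
  | sub a b => a.eval s - b.eval s

def cost : IExp → ℕ
  | lit _ => 1
  | var _ => 1
  | get _ i j => i.cost + j.cost + 1
  | add a b => a.cost + b.cost + 1
  | sub a b => a.cost + b.cost + 1

end IExp

namespace RExp

noncomputable def eval (s : State) : RExp → ℝ
  | zero => 0
  | one => 1
  | get k i j => s.rarr k (i.eval s) (j.eval s)
  | add a b => a.eval s + b.eval s
  | sub a b => a.eval s - b.eval s
  | mul a b => a.eval s * b.eval s
  | div a b => a.eval s / b.eval s

def cost : RExp → ℕ
  | zero => 1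
  | one => 1
  | get _ i j => i.cost + j.cost + 1
  | add a b => a.cost + b.cost + 1
  | sub a b => a.cost + b.cost + 1
  | mul a b => a.cost + b.cost + 1
  | div a b => a.cost + b.cost + 1

end RExp

namespace BExp

def Holds (s : State) : BExp → Prop
  | ieq a b => a.eval s = b.eval s
  | ilt a b => a.eval s < b.eval s
  | req a b => a.eval s = b.eval s
  | rlt a b => a.eval s < b.eval s
  | not a => ¬ a.Holds s
  | and a b => a.Holds s ∧ b.Holds s

def cost : BExp → ℕ
  | ieq a b => a.cost + b.cost + 1
  | ilt a b => a.cost + b.cost + 1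
  | req a b => a.cost + b.cost + 1
  | rlt a b => a.cost + b.cost + 1
  | not a => a.cost + 1
  | and a b => a.cost + b.cost + 1

end BExp

namespace State

def setVar (s : State) (x v : ℕ) : State :=
  { s with ivar := Function.update s.ivar x v }

def setInt (s : State) (k i j v : ℕ) : State :=
  { s with iarr := fun k' i' j' => if k' = k ∧ i' = i ∧ j' = j then v else s.iarr k' i' j' }

noncomputable def setReal (s : State) (k i j : ℕ) (v : ℝ) : State :=
  { s with rarr := fun k' i' j' => if k' = k ∧ i' = i ∧ j' = j then v else s.rarr k' i' j' }

end State

/-- `Exec c s t s'`: the program `c`, started in memory `s`, halts after `t` steps with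
memory `s'`. -/
inductive Exec : Prog → State → ℕ → State → Prop
  | skip (s : State) : Exec .skip s 1 s
  | setVar (x : ℕ) (a : IExp) (s : State) :
      Exec (.setVar x a) s (a.cost + 1) (s.setVar x (a.eval s))
  | setInt (k : ℕ) (i j a : IExp) (s : State) :
      Exec (.setInt k i j a) s (i.cost + j.cost + a.cost + 1)
        (s.setInt k (i.eval s) (j.eval s) (a.eval s))
  | setReal (k : ℕ) (i j : IExp) (a : RExp) (s : State) :
      Exec (.setReal k i j a) s (i.cost + j.cost + a.cost + 1)
        (s.setReal k (i.eval s) (j.eval s) (a.eval s))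
  | seq {c d : Prog} {s s' s'' : State} {t t' : ℕ} :
      Exec c s t s' → Exec d s' t' s'' → Exec (.seq c d) s (t + t') s''
  | ite_true {b : BExp} {c d : Prog} {s s' : State} {t : ℕ} :
      b.Holds s → Exec c s t s' → Exec (.ite b c d) s (b.cost + t) s'
  | ite_false {b : BExp} {c d : Prog} {s s' : State} {t : ℕ} :
      ¬ b.Holds s → Exec d s t s' → Exec (.ite b c d) s (b.cost + t) s'
  | while_true {b : BExp} {c : Prog} {s s' s'' : State} {t t' : ℕ} :
      b.Holds s → Exec c s t s' → Exec (.while b c) s' t' s'' →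
      Exec (.while b c) s (b.cost + t + t') s''
  | while_false {b : BExp} {c : Prog} {s : State} :
      ¬ b.Holds s → Exec (.while b c) s b.cost s

/-- Programs are deterministic: the running time and the final memory are determined by the
program and the initial memory. -/
theorem Exec.deterministic {c : Prog} {s s₁ s₂ : State} {t₁ t₂ : ℕ}
    (h₁ : Exec c s t₁ s₁) (h₂ : Exec c s t₂ s₂) : t₁ = t₂ ∧ s₁ = s₂ := by
  induction h₁ generalizing t₂ s₂ with
  | skip s => cases h₂; exact ⟨rfl, rfl⟩
  | setVar x a s => cases h₂; exact ⟨rfl, rfl⟩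
  | setInt k i j a s => cases h₂; exact ⟨rfl, rfl⟩
  | setReal k i j a s => cases h₂; exact ⟨rfl, rfl⟩
  | seq _ _ ih ih' =>
    cases h₂ with
    | seq g g' =>
      obtain ⟨rfl, rfl⟩ := ih g
      obtain ⟨rfl, rfl⟩ := ih' g'
      exact ⟨rfl, rfl⟩
  | ite_true hb _ ih =>
    cases h₂ with
    | ite_true _ g => obtain ⟨rfl, rfl⟩ := ih g; exact ⟨rfl, rfl⟩
    | ite_false hb' _ => exact absurd hb hb'
  | ite_false hb _ ih =>
    cases h₂ with
    | ite_true hb' _ => exact absurd hb' hb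
    | ite_false _ g => obtain ⟨rfl, rfl⟩ := ih g; exact ⟨rfl, rfl⟩
  | while_true hb _ _ ih ih' =>
    cases h₂ with
    | while_true _ g g' =>
      obtain ⟨rfl, rfl⟩ := ih g
      obtain ⟨rfl, rfl⟩ := ih' g'
      exact ⟨rfl, rfl⟩
    | while_false hb' => exact absurd hb hb'
  | while_false hb =>
    cases h₂ with
    | while_true hb' _ _ => exact absurd hb' hb
    | while_false _ => exact ⟨rfl, rfl⟩

/-- The input: the integer variables `0, 1, 2` hold `m`, `n`, `r`; the integer array `0` is the
adjacency matrix of the sampling graph; the real array `0` holds the sampled entries, with `0` at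
the positions that are not sampled.  All other memory is zero. -/
noncomputable def input {m n : ℕ} (E : Finset (Fin m × Fin n))
    (z : {e : Fin m × Fin n // e ∈ E} → ℝ) (r : ℕ) : State where
  ivar := fun x => if x = 0 then m else if x = 1 then n else if x = 2 then r else 0
  iarr := fun k i j =>
    if ∃ (hi : i < m) (hj : j < n), k = 0 ∧ (⟨i, hi⟩, ⟨j, hj⟩) ∈ E then 1 else 0
  rarr := fun k i j =>
    if h : ∃ (hi : i < m) (hj : j < n), k = 0 ∧ (⟨i, hi⟩, ⟨j, hj⟩) ∈ E then
      z ⟨(⟨i, h.1⟩, ⟨j, h.2.1⟩), h.2.2.2⟩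
    else 0

end LRMC

/-!
In a staircase pattern every row and every column has a type, its position in the chain, and whether
a position is sampled depends on the two types only. Completion is unique precisely when, for every
unsampled position `(i, j)`, its corner (the sampled block of `Z` in rows sampled in column `j` and
columns sampled in row `i`) is empty or has the full rank `Z.rank`.

If all these corners are full, then every solution agrees with `Z`: a full block determines the
entries in its row and column span, and one propagates from block to block along the chain. For the
converse, every corner is a bottleneck, the only connection between the two sides of the pattern. If
it is not full, factor `Z = P * Q` with inner dimension `Z.rank`; an invertible rank one
perturbation of the identity that is invisible in the bottleneck moves the two sides of the
factorization against each other and yields another solution.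

The rank of a corner is found in polynomial time by repeated rank one deflation.
-/

namespace LRMC

open Matrix

/-! ### Rank and blocks -/

section LinearAlgebra

variable {K ι κ μ : Type*} [Field K] [Fintype κ]

theorem exists_rank_factorization (Z : Matrix ι κ K) :
    ∃ (P : Matrix ι (Fin Z.rank) K) (Q : Matrix (Fin Z.rank) κ K), P * Q = Z := by
  classical
  let b : Module.Basis (Fin Z.rank) K (LinearMap.range Z.mulVecLin) :=
    Module.finBasisOfFinrankEq _ _ rfl
  let column (j : κ) : LinearMap.range Z.mulVecLin :=
    ⟨Z.mulVecLin (Pi.single j 1), LinearMap.mem_range_self _ _⟩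
  refine ⟨of fun i a => (b a : ι → K) i, of fun a j => b.repr (column j) a, ?_⟩
  ext i j
  have expansion := congrArg (fun w : LinearMap.range Z.mulVecLin => (w : ι → K) i)
    (b.sum_repr (column j))
  simpa [-Module.Basis.sum_repr, column, mul_apply, mul_comm] using expansion

theorem mulVec_injective_of_rank_eq_card {A : Matrix ι κ K} (h : A.rank = Fintype.card κ) :
    Function.Injective A.mulVec := by
  rw [mulVec_injective_iff, linearIndependent_iff_card_eq_finrank_span, ← h,
    rank_eq_finrank_span_cols, Set.finrank]

theorem vecMul_injective_of_rank_eq_card [Fintype ι] {A : Matrix ι κ K}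
    (h : A.rank = Fintype.card ι) : Function.Injective fun v => v ᵥ* A := by
  simp_rw [← mulVec_transpose]
  exact mulVec_injective_of_rank_eq_card ((rank_transpose A).trans h)

theorem rank_mul_eq_right_of_mulVec_injective [Fintype μ] {A : Matrix ι κ K}
    (hA : Function.Injective A.mulVec) (B : Matrix κ μ K) : (A * B).rank = B.rank := by
  rw [rank, mulVecLin_mul, LinearMap.range_comp]
  exact (Submodule.equivMapOfInjective A.mulVecLin hA _).finrank_eq.symm

theorem rank_eq_card_of_vecMul_injective [Fintype ι] {A : Matrix ι κ K}
    (hA : Function.Injective fun v => v ᵥ* A) : A.rank = Fintype.card ι :=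
  (vecMul_injective_iff.1 hA).rank_matrix

theorem mulVec_eq_zero_of_rank_mul_eq_right [Finite ι] [Fintype μ] {A : Matrix ι κ K}
    {M : Matrix κ μ K} (h : (A * M).rank = M.rank) {d : μ → K} (hd : (A * M) *ᵥ d = 0) :
    M *ᵥ d = 0 := by
  have ker_le : LinearMap.ker M.mulVecLin ≤ LinearMap.ker (A * M).mulVecLin := by
    rw [mulVecLin_mul]
    exact LinearMap.ker_le_ker_comp _ _
  have ker_eq := Submodule.eq_of_le_of_finrank_eq ker_le (by
    have := M.mulVecLin.finrank_range_add_finrank_ker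
    have := (A * M).mulVecLin.finrank_range_add_finrank_ker
    simp only [rank] at h
    omega)
  have hd' : d ∈ LinearMap.ker M.mulVecLin := ker_eq ▸ hd
  exact hd'

theorem exists_mulVec_eq_of_rank_mul_eq_left [Fintype μ] {M : Matrix ι κ K} {A : Matrix κ μ K}
    (h : (M * A).rank = M.rank) (d : κ → K) : ∃ c, (M * A) *ᵥ c = M *ᵥ d := by
  have range_le : LinearMap.range (M * A).mulVecLin ≤ LinearMap.range M.mulVecLin := by
    rw [mulVecLin_mul]
    exact LinearMap.range_comp_le_range _ _
  have hd : M *ᵥ d ∈ LinearMap.range (M * A).mulVecLin :=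
    Submodule.eq_of_le_of_finrank_eq range_le h ▸ LinearMap.mem_range_self M.mulVecLin d
  exact hd

theorem rank_add_le (A B : Matrix ι κ K) : (A + B).rank ≤ A.rank + B.rank := by
  rw [rank, mulVecLin_add]
  exact (Submodule.finrank_mono (LinearMap.range_add_le _ _)).trans
    (Submodule.finrank_add_le_finrank_add_finrank _ _)

/-- Wedderburn's rank reduction: the rank one matrix spanned by the row and the column through the
pivot `(p, q)` is subtracted from `B`. -/
def deflate (B : Matrix ι κ K) (p : ι) (q : κ) : Matrix ι κ K :=
  of fun x y => B x y - B x q * B p y / B p q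

omit [Fintype κ] in
theorem deflate_apply_pivotRow (B : Matrix ι κ K) {p : ι} {q : κ} (h : B p q ≠ 0) (y : κ) :
    deflate B p q p y = 0 := by
  simp [deflate, mul_div_cancel_left₀ _ h]

theorem rank_deflate (B : Matrix ι κ K) {p : ι} {q : κ} (h : B p q ≠ 0) :
    (deflate B p q).rank + 1 = B.rank := by
  classical
  apply le_antisymm
  · have deflate_eq_mul :
        deflate B p q = B * (1 - vecMulVec (Pi.single q 1) fun y => B p y / B p q) := by
      ext x y
      simp [deflate, Matrix.mul_sub, mul_vecMulVec, vecMulVec_apply, mul_div_assoc]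
    have range_le : LinearMap.range (deflate B p q).mulVecLin ≤ LinearMap.range B.mulVecLin := by
      rw [deflate_eq_mul, mulVecLin_mul]
      exact LinearMap.range_comp_le_range _ _
    have range_apply_pivotRow : ∀ w ∈ LinearMap.range (deflate B p q).mulVecLin, w p = 0 := by
      rintro w ⟨v, rfl⟩
      simp [mulVec, dotProduct, deflate_apply_pivotRow B h]
    refine Submodule.finrank_lt_finrank_of_lt (range_le.lt_of_ne fun range_eq => h ?_)
    simpa using range_apply_pivotRow (B.mulVecLin (Pi.single q 1))
      (range_eq ▸ LinearMap.mem_range_self _ _)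
  · have eq_deflate_add :
        B = deflate B p q + vecMulVec (fun x => B x q) fun y => B p y / B p q := by
      ext x y
      simp [deflate, vecMulVec_apply, mul_div_assoc]
    conv_lhs => rw [eq_deflate_add]
    exact (rank_add_le _ _).trans (Nat.add_le_add_left (rank_vecMulVec_le _ _) _)

open Classical in
/-- The block of `Z` with rows in `X` and columns in `Y`, padded by zeros. -/
noncomputable def block (X : ι → Prop) (Y : κ → Prop) (Z : Matrix ι κ K) : Matrix ι κ K :=
  of fun i j => if X i ∧ Y j then Z i j else 0

open Classical in
theorem block_eq_mul [Fintype ι] (X : ι → Prop) (Y : κ → Prop) (Z : Matrix ι κ K) :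
    block X Y Z = diagonal (fun i => if X i then (1 : K) else 0) *
      (Z * diagonal fun j => if Y j then (1 : K) else 0) := by
  ext i j
  by_cases hi : X i <;> by_cases hj : Y j <;> simp [block, hi, hj]

variable [Finite ι]

theorem rank_block_le (X : ι → Prop) (Y : κ → Prop) (Z : Matrix ι κ K) :
    (block X Y Z).rank ≤ Z.rank := by
  classical
  cases nonempty_fintype ι
  rw [block_eq_mul]
  exact (rank_mul_le_right _ _).trans (rank_mul_le_left _ _)

theorem exists_mulVec_eq_col_of_rank_block {X : ι → Prop} {Y : κ → Prop} {M : Matrix ι κ K}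
    (h : (block X Y M).rank = M.rank) (j : κ) :
    ∃ c : κ → K, (∀ y, ¬ Y y → c y = 0) ∧ M *ᵥ c = M.col j := by
  classical
  cases nonempty_fintype ι
  rw [block_eq_mul] at h
  obtain ⟨c, hc⟩ := exists_mulVec_eq_of_rank_mul_eq_left
    ((rank_mul_le_left _ _).antisymm (h.symm.le.trans (rank_mul_le_right _ _))) (Pi.single j 1)
  refine ⟨fun y => if Y y then c y else 0, fun y hy => if_neg hy, ?_⟩
  rw [← mulVec_single_one, ← hc, ← mulVec_mulVec]
  congr 1
  ext y
  simp [mulVec_diagonal]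

theorem mulVec_eq_zero_of_rank_block {X : ι → Prop} {Y : κ → Prop} {M : Matrix ι κ K}
    (h : (block X Y M).rank = M.rank) {d : κ → K} (hd : ∀ x, X x → (M *ᵥ d) x = 0) :
    M *ᵥ d = 0 := by
  classical
  cases nonempty_fintype ι
  rw [block_eq_mul, ← Matrix.mul_assoc] at h
  refine mulVec_eq_zero_of_rank_mul_eq_right
    ((rank_mul_le_right _ _).antisymm (h.symm.le.trans (rank_mul_le_left _ _))) ?_
  ext x
  by_cases hx : X x <;> simp [← mulVec_mulVec, mulVec_diagonal, hx, hd]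

-- A relation `M *ᵥ c = M.col j` with `c` supported on `Y` passes to the other matrix, because it
-- only has to be checked on the rows in `X`.
theorem apply_eq_of_rank_block {X : ι → Prop} {Y : κ → Prop} {M M' : Matrix ι κ K}
    (hM' : M'.rank ≤ M.rank) (hr : (block X Y M).rank = M.rank)
    (hXY : ∀ x y, X x → Y y → M x y = M' x y) {i : ι} {j : κ}
    (hi : ∀ y, Y y → M i y = M' i y) (hj : ∀ x, X x → M x j = M' x j) : M i j = M' i j := by
  classical
  have block_eq : block X Y M' = block X Y M := by
    ext x y
    by_cases h : X x ∧ Y y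
    · simp [block, h, hXY x y h.1 h.2]
    · simp [block, h]
  have hr' : (block X Y M').rank = M'.rank :=
    (rank_block_le _ _ _).antisymm (hM'.trans (by rw [block_eq, hr]))
  obtain ⟨c, c_supp, hc⟩ := exists_mulVec_eq_col_of_rank_block hr j
  let d := c - Pi.single j 1
  have M'_d (x : ι) (hx : ∀ y, Y y → M x y = M' x y) : (M' *ᵥ d) x = M x j - M' x j := by
    have : (M' *ᵥ c) x = (M *ᵥ c) x := Finset.sum_congr rfl fun y _ => by
      by_cases hy : Y y <;> simp [hx, c_supp, hy]
    rw [mulVec_sub, Pi.sub_apply, this, hc, mulVec_single_one, col_apply, col_apply]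
  have M'_d_eq_zero : M' *ᵥ d = 0 := mulVec_eq_zero_of_rank_block hr' fun x hx => by
    rw [M'_d x (hXY x · hx), hj x hx, sub_self]
  exact sub_eq_zero.1 ((M'_d i hi).symm.trans (congrFun M'_d_eq_zero i))

end LinearAlgebra

/-! ### Rigidity -/

section Rigid

variable {K ι κ ρ : Type*} [Field K] [Fintype κ] [Fintype ρ]

/-- `Z` is the only matrix of rank at most `Z.rank` that agrees with `Z` on the pattern `E`. -/
def Rigid (E : ι → κ → Prop) (Z : Matrix ι κ K) : Prop :=
  ∀ M : Matrix ι κ K, (∀ i j, E i j → M i j = Z i j) → M.rank ≤ Z.rank → M = Z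

theorem Rigid.transpose [Fintype ι] {E : ι → κ → Prop} {Z : Matrix ι κ K} (h : Rigid E Z) :
    Rigid (fun j i => E i j) Zᵀ := by
  intro M hM hr
  rw [rank_transpose] at hr
  rw [← h Mᵀ (fun i j hij => hM j i hij) (by rwa [rank_transpose]), transpose_transpose]

theorem Rigid.mul_eq {E : ι → κ → Prop} {P : Matrix ι ρ K} {Q : Matrix ρ κ K}
    (hrig : Rigid E (P * Q)) (hr : (P * Q).rank = Fintype.card ρ) (P' : Matrix ι ρ K)
    (Q' : Matrix ρ κ K) (h : ∀ i j, E i j → (P' * Q') i j = (P * Q) i j) : P' * Q' = P * Q :=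
  hrig _ h (hr ▸ (rank_mul_le_left _ _).trans (rank_le_card_width P'))

theorem Rigid.exists_edge_of_ne_zero {E : ι → κ → Prop} {P : Matrix ι ρ K} {Q : Matrix ρ κ K}
    (hrig : Rigid E (P * Q)) (hr : (P * Q).rank = Fintype.card ρ) {v : ρ → K} (hv : v ᵥ* Q ≠ 0)
    (i : ι) : ∃ j, E i j ∧ (v ᵥ* Q) j ≠ 0 := by
  classical
  by_contra! hE
  have mul_eq : P.updateRow i (P i + v) * Q = P * Q := by
    refine hrig.mul_eq hr _ _ fun i' j hij => ?_
    rw [updateRow_mul, add_vecMul]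
    obtain rfl | hi := eq_or_ne i' i
    · rw [updateRow_self, Pi.add_apply, hE j hij, add_zero]
      rfl
    · simp [hi]
  refine hv (funext fun j => ?_)
  have entry_eq := congrFun (congrFun mul_eq i) j
  rw [updateRow_mul, updateRow_self, add_vecMul] at entry_eq
  exact add_eq_left.1 entry_eq

theorem one_sub_smul_vecMulVec_mul_one_add_vecMulVec [DecidableEq ρ] {v w : ρ → K}
    (h : 1 + v ⬝ᵥ w ≠ 0) :
    (1 - (1 + v ⬝ᵥ w)⁻¹ • vecMulVec w v) * (1 + vecMulVec w v) = 1 := by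
  have square : vecMulVec w v * vecMulVec w v = (v ⬝ᵥ w) • vecMulVec w v := by
    rw [vecMulVec_mul_vecMulVec]
    ext a b
    simp [vecMulVec_apply, mul_left_comm]
  rw [sub_mul, one_mul, mul_add, mul_one, smul_mul_assoc, square, ← smul_add]
  nth_rw 2 [← one_smul K (vecMulVec w v)]
  rw [← add_smul, inv_smul_smul₀ h, add_sub_cancel_right]

section Shear

variable {E : ι → κ → Prop} {P : Matrix ι ρ K} {Q : Matrix ρ κ K} {L : ι → Prop} {C : κ → Prop}

-- Let `g` act on the columns outside `C` and its inverse `h` on the rows outside `L`: the product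
-- changes only at the positions where exactly one of the two acts.
theorem Rigid.mul_apply_eq_of_mul_eq_one [DecidableEq ρ] (hrig : Rigid E (P * Q))
    (hr : (P * Q).rank = Fintype.card ρ) (hE : ∀ i j, ¬ L i → C j → ¬ E i j)
    {g h : Matrix ρ ρ K} (hg : h * g = 1)
    (hgE : ∀ i j, L i → ¬ C j → E i j → (P * (g * Q)) i j = (P * Q) i j) (i : ι) (j : κ) :
    (L i → ¬ C j → (P * (g * Q)) i j = (P * Q) i j) ∧
      (¬ L i → C j → (P * h * Q) i j = (P * Q) i j) := by
  classical
  let P' : Matrix ι ρ K := of fun i => if L i then P i else (P * h) i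
  let Q' : Matrix ρ κ K := of fun a j => if C j then Q a j else (g * Q) a j
  have mul_apply_of_mem : ∀ i j, L i → ¬ C j → (P' * Q') i j = (P * (g * Q)) i j := by
    intro i j hi hj
    simp [P', Q', mul_apply (M := P), mul_apply (M := P'), hi, hj]
  have mul_apply_of_notMem : ∀ i j, ¬ L i → C j → (P' * Q') i j = (P * h * Q) i j := by
    intro i j hi hj
    simp [P', Q', mul_apply (N := Q), mul_apply (M := P'), hi, hj]
  have mul_apply_of_iff : ∀ i j, (L i ↔ C j) → (P' * Q') i j = (P * Q) i j := by
    intro i j hij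
    by_cases hi : L i
    · simp [P', Q', mul_apply, hi, hij.1 hi]
    · have : P * Q = P * h * (g * Q) := by
        rw [Matrix.mul_assoc, ← Matrix.mul_assoc h, hg, Matrix.one_mul]
      simp [this, P', Q', mul_apply (M := P * h), mul_apply (M := P'), hi, mt hij.2 hi]
  have mul_eq : P' * Q' = P * Q := hrig.mul_eq hr P' Q' fun i j hij => by
    by_cases hi : L i <;> by_cases hj : C j
    · exact mul_apply_of_iff i j (by simp [hi, hj])
    · rw [mul_apply_of_mem i j hi hj, hgE i j hi hj hij]
    · exact absurd hij (hE i j hi hj)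
    · exact mul_apply_of_iff i j (by simp [hi, hj])
  exact ⟨fun hi hj => by rw [← mul_apply_of_mem i j hi hj, mul_eq],
    fun hi hj => by rw [← mul_apply_of_notMem i j hi hj, mul_eq]⟩

theorem Rigid.mulVec_mul_vecMul_eq_zero (hrig : Rigid E (P * Q))
    (hr : (P * Q).rank = Fintype.card ρ) (hE : ∀ i j, ¬ L i → C j → ¬ E i j) {v w : ρ → K}
    (hvE : ∀ i j, L i → ¬ C j → E i j → (v ᵥ* Q) j = 0) (hw : 1 + v ⬝ᵥ w ≠ 0) {i : ι} {j : κ}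
    (hij : L i ↔ ¬ C j) : (P *ᵥ w) i * (v ᵥ* Q) j = 0 := by
  classical
  have left_apply : ∀ i j, (P * ((1 + vecMulVec w v : Matrix ρ ρ K) * Q)) i j =
      (P * Q) i j + (P *ᵥ w) i * (v ᵥ* Q) j := by
    intro i j
    rw [Matrix.add_mul, Matrix.one_mul, vecMulVec_mul, Matrix.mul_add, mul_vecMulVec,
      Matrix.add_apply, vecMulVec_apply]
  have right_apply : (P * (1 - (1 + v ⬝ᵥ w)⁻¹ • vecMulVec w v : Matrix ρ ρ K) * Q) i j =
      (P * Q) i j - (1 + v ⬝ᵥ w)⁻¹ * ((P *ᵥ w) i * (v ᵥ* Q) j) := by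
    rw [Matrix.mul_sub, Matrix.mul_one, Matrix.mul_smul, mul_vecMulVec, Matrix.sub_mul,
      Matrix.smul_mul, vecMulVec_mul, Matrix.sub_apply, Matrix.smul_apply, vecMulVec_apply,
      smul_eq_mul]
  obtain ⟨left_eq, right_eq⟩ := hrig.mul_apply_eq_of_mul_eq_one hr hE
    (one_sub_smul_vecMulVec_mul_one_add_vecMulVec hw)
    (fun i j hi hj hij => by rw [left_apply, hvE i j hi hj hij, mul_zero, add_zero]) i j
  by_cases hi : L i
  · simpa [left_apply] using left_eq hi (hij.1 hi)
  · simpa [right_apply, hw] using right_eq hi (not_not.1 (mt hij.2 hi))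

theorem Rigid.row_eq_zero [Nontrivial Kˣ] (hrig : Rigid E (P * Q))
    (hr : (P * Q).rank = Fintype.card ρ) (hE : ∀ i j, ¬ L i → C j → ¬ E i j) {v : ρ → K}
    (hvE : ∀ i j, L i → ¬ C j → E i j → (v ᵥ* Q) j = 0) {i : ι} {j : κ}
    (hij : L i ↔ ¬ C j) (hj : (v ᵥ* Q) j ≠ 0) : P i = 0 := by
  classical
  ext a
  obtain ⟨c, hc⟩ : ∃ c : Kˣ, 1 + v ⬝ᵥ Pi.single a (c : K) ≠ 0 := by
    by_contra! h
    simp only [dotProduct_single] at h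
    have hv : v a ≠ 0 := fun hv => by simpa [hv] using h 1
    obtain ⟨c, hc⟩ := exists_ne (1 : Kˣ)
    exact hc (Units.ext (mul_left_cancel₀ hv (add_left_cancel ((h c).trans (h 1).symm))))
  simpa [hj] using hrig.mulVec_mul_vecMul_eq_zero hr hE hvE hc hij

theorem Rigid.eq_zero_of_vecMul_eq_zero [Nontrivial Kˣ] (hrig : Rigid E (P * Q))
    (hr : (P * Q).rank = Fintype.card ρ) (hE : ∀ i j, ¬ L i → C j → ¬ E i j) {v : ρ → K}
    (hvE : ∀ i j, L i → ¬ C j → E i j → (v ᵥ* Q) j = 0) (hL : ∃ i, L i) (hL' : ∃ i, ¬ L i) :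
    v = 0 := by
  by_contra hv
  have rank_Q : Q.rank = Fintype.card ρ :=
    (rank_le_card_height Q).antisymm (hr.symm.le.trans (rank_mul_le_right _ _))
  have hvQ : v ᵥ* Q ≠ 0 := fun h =>
    hv (vecMul_injective_of_rank_eq_card rank_Q (h.trans (zero_vecMul Q).symm))
  obtain ⟨i₁, hi₁⟩ := hL
  obtain ⟨j₁, hij₁, hj₁⟩ := hrig.exists_edge_of_ne_zero hr hvQ i₁
  have hC₁ : C j₁ := not_not.1 fun hC => hj₁ (hvE i₁ j₁ hi₁ hC hij₁)
  obtain ⟨i₂, hi₂⟩ := hL'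
  obtain ⟨j₂, hij₂, hj₂⟩ := hrig.exists_edge_of_ne_zero hr hvQ i₂
  have hC₂ : ¬ C j₂ := fun hC => hE i₂ j₂ hi₂ hC hij₂
  have hP : P = 0 := Matrix.ext_row fun i => by
    by_cases hi : L i
    · exact hrig.row_eq_zero hr hE hvE (by simp [hi, hC₂]) hj₂
    · exact hrig.row_eq_zero hr hE hvE (by simp [hi, hC₁]) hj₁
  have : IsEmpty ρ := Fintype.card_eq_zero_iff.1 (by simpa [hP] using hr.symm)
  exact hv (Subsingleton.elim _ _)

end Shear

theorem Rigid.vecMul_mul_diagonal_injective [Nontrivial Kˣ] [DecidableEq κ] {E : ι → κ → Prop}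
    {P : Matrix ι ρ K} {Q : Matrix ρ κ K} (hrig : Rigid E (P * Q))
    (hr : (P * Q).rank = Fintype.card ρ) {L : ι → Prop} {C Y : κ → Prop} [DecidablePred Y]
    (hE : ∀ i j, ¬ L i → C j → ¬ E i j) (hY : ∀ i j, L i → ¬ C j → E i j → Y j)
    (hL : ∃ i, L i) (hL' : ∃ i, ¬ L i) :
    Function.Injective fun v => v ᵥ* (Q * diagonal fun j => if Y j then (1 : K) else 0) := by
  refine (injective_iff_map_eq_zero (Matrix.vecMulLinear _)).2 fun v hv => ?_
  refine hrig.eq_zero_of_vecMul_eq_zero hr hE (fun i j hi hj hij => ?_) hL hL'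
  simpa [← vecMul_vecMul, vecMul_diagonal, hY i j hi hj hij] using congrFun hv j

theorem Rigid.rank_block_mul [Nontrivial Kˣ] [Finite ι] {E : ι → κ → Prop} {P : Matrix ι ρ K}
    {Q : Matrix ρ κ K} (hrig : Rigid E (P * Q)) (hr : (P * Q).rank = Fintype.card ρ)
    {L X : ι → Prop} {C Y : κ → Prop} (hE : ∀ i j, ¬ L i → C j → ¬ E i j)
    (hXY : ∀ i j, L i → ¬ C j → E i j → X i ∧ Y j)
    (hL : ∃ i, L i) (hL' : ∃ i, ¬ L i) (hC : ∃ j, C j) (hC' : ∃ j, ¬ C j) :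
    (block X Y (P * Q)).rank = Fintype.card ρ := by
  classical
  cases nonempty_fintype ι
  have right_injective := hrig.vecMul_mul_diagonal_injective hr hE
    (fun i j hi hj hij => (hXY i j hi hj hij).2) hL hL'
  have hrigT := hrig.transpose
  rw [← rank_transpose] at hr
  rw [transpose_mul] at hrigT hr
  have left_injective := hrigT.vecMul_mul_diagonal_injective hr (L := fun j => ¬ C j)
    (C := fun i => ¬ L i) (fun j i hj hi => hE i j hi (not_not.1 hj))
    (fun j i hj hi hij => (hXY i j (not_not.1 hi) hj hij).1) hC' (by simpa using hC)
  have left_injective' :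
      Function.Injective (diagonal (fun i => if X i then (1 : K) else 0) * P).mulVec := by
    intro v w hvw
    refine left_injective ?_
    simpa [← mulVec_transpose] using hvw
  rw [block_eq_mul, Matrix.mul_assoc, ← Matrix.mul_assoc,
    rank_mul_eq_right_of_mulVec_injective left_injective',
    rank_eq_card_of_vecMul_injective right_injective]

theorem Rigid.rank_block_eq [Nontrivial Kˣ] [Finite ι] {E : ι → κ → Prop} {Z : Matrix ι κ K}
    (hrig : Rigid E Z) {L X : ι → Prop} {C Y : κ → Prop}
    (hE : ∀ i j, ¬ L i → C j → ¬ E i j) (hXY : ∀ i j, L i → ¬ C j → E i j → X i ∧ Y j)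
    (hL : ∃ i, L i) (hL' : ∃ i, ¬ L i) (hC : ∃ j, C j) (hC' : ∃ j, ¬ C j) :
    (block X Y Z).rank = Z.rank := by
  obtain ⟨P, Q, hPQ⟩ := exists_rank_factorization Z
  rw [← hPQ] at hrig
  have := hrig.rank_block_mul (by rw [hPQ, Fintype.card_fin]) hE hXY hL hL' hC hC'
  rwa [hPQ, Fintype.card_fin] at this

end Rigid

/-! ### Staircase patterns -/

section Staircase

variable {ι κ : Type*}

/-- The members of a chain of sets, alternately increasing and decreasing, that contain an element
of type `t`: the member `t` and, if it is a local minimum of the chain, both its neighbours. The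
local minima are the indices of parity opposite to `e`. -/
abbrev TypeMem (e t i : ℕ) : Prop :=
  i = t ∨ ((t + e) % 2 = 1 ∧ (i = t + 1 ∨ t = i + 1))

/-- The rows and columns carry types in `1, …, l`, and whether a position belongs to the pattern
`E` depends on the types only: row and column have equal types, or neighbouring types and the type
of the row has the parity opposite to `e`. -/
structure IsStaircase (E : ι → κ → Prop) (l e : ℕ) (τ : ι → ℕ) (σ : κ → ℕ) : Prop where
  row_mem : ∀ x, 1 ≤ τ x ∧ τ x ≤ l
  col_mem : ∀ y, 1 ≤ σ y ∧ σ y ≤ l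
  iff : ∀ x y, E x y ↔ TypeMem e (τ x) (σ y)
  row_surj : ∀ k, 1 ≤ k → k ≤ l → (k + e) % 2 = 1 → ∃ x, τ x = k
  col_surj : ∀ k, 1 ≤ k → k ≤ l → (k + e) % 2 = 0 → ∃ y, σ y = k

theorem IsStaircase.transpose {E : ι → κ → Prop} {l e : ℕ} {τ : ι → ℕ} {σ : κ → ℕ}
    (h : IsStaircase E l e τ σ) : IsStaircase (fun y x => E x y) l (e + 1) σ τ where
  row_mem := h.col_mem
  col_mem := h.row_mem
  iff y x := by rw [h.iff]; omega
  row_surj k h1 h2 h3 := h.col_surj k h1 h2 (by omega)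
  col_surj k h1 h2 h3 := h.row_surj k h1 h2 (by omega)

theorem exists_type_of_chain {α : Type*} {l e : ℕ} {W : ℕ → Finset α}
    (hup : ∀ i, 1 ≤ i → i + 1 ≤ l → (i + e) % 2 = 1 → W i ⊆ W (i + 1))
    (hdown : ∀ i, 1 ≤ i → i + 1 ≤ l → (i + e) % 2 = 0 → W (i + 1) ⊆ W i)
    (hdisj : ∀ i, 1 ≤ i → i + 2 ≤ l → (i + e) % 2 = 1 → Disjoint (W i) (W (i + 2)))
    (hcons : ∀ i j k, 1 ≤ i → i ≤ j → j ≤ k → k ≤ l → ∀ x, x ∈ W i → x ∈ W k → x ∈ W j)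
    (hcover : ∀ x, ∃ i, 1 ≤ i ∧ i ≤ l ∧ x ∈ W i) (x : α) :
    ∃ t, (1 ≤ t ∧ t ≤ l) ∧ ∀ i, 1 ≤ i → i ≤ l → (x ∈ W i ↔ TypeMem e t i) := by
  by_cases hmin : ∃ t, 1 ≤ t ∧ t ≤ l ∧ x ∈ W t ∧ (t + e) % 2 = 1
  · obtain ⟨t, ht1, ht2, hx, hpar⟩ := hmin
    refine ⟨t, ⟨ht1, ht2⟩, fun i hi1 hi2 => ⟨fun hxi => ?_, ?_⟩⟩
    · by_contra hit
      rcases Nat.lt_or_ge i t with hlt | hge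
      · have hx' := hcons i (t - 2) t hi1 (by omega) (by omega) ht2 x hxi hx
        have disjoint := hdisj (t - 2) (by omega) (by omega) (by omega)
        rw [show t - 2 + 2 = t by omega] at disjoint
        exact Finset.disjoint_left.1 disjoint hx' hx
      · have hx' := hcons t (t + 2) i ht1 (by omega) (by omega) hi2 x hx hxi
        exact Finset.disjoint_left.1 (hdisj t ht1 (by omega) hpar) hx hx'
    · rintro (rfl | ⟨-, rfl | rfl⟩)
      · exact hx
      · exact hup t ht1 hi2 hpar hx
      · exact hdown i hi1 ht2 (by omega) hx
  · push Not at hmin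
    obtain ⟨t, ht1, ht2, hx⟩ := hcover x
    refine ⟨t, ⟨ht1, ht2⟩, fun i hi1 hi2 => ⟨fun hxi => ?_, ?_⟩⟩
    · have hpar := hmin i hi1 hi2 hxi
      by_contra hit
      rcases Nat.lt_or_ge i t with hlt | hge
      · exact hmin (i + 1) (by omega) (by omega)
          (hcons i (i + 1) t hi1 (by omega) (by omega) ht2 x hxi hx) (by omega)
      · exact hmin (i - 1) (by omega) (by omega)
          (hcons t (i - 1) i ht1 (by omega) (by omega) hi2 x hx hxi) (by omega)
    · rintro (rfl | ⟨hpar, -⟩)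
      · exact hx
      · exact absurd hpar (hmin t ht1 ht2 hx)

namespace IsBicliqueChain

variable {m n : ℕ} {E : Finset (Fin m × Fin n)} {l : ℕ} {U : ℕ → Finset (Fin m)}
  {V : ℕ → Finset (Fin n)}

theorem subset_of_odd (h : IsBicliqueChain E l U V) {i : ℕ} (hi : 1 ≤ i) (hil : i + 1 ≤ l)
    (hpar : i % 2 = 1) : U i ⊆ U (i + 1) ∧ V (i + 1) ⊆ V i := by
  by_cases hil' : i + 2 ≤ l
  · obtain ⟨hV, hU, -⟩ := h.odd_step i hi hil' (Nat.odd_iff.2 hpar)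
    exact ⟨Finset.inter_eq_left.1 hU, hV ▸ Finset.inter_subset_left⟩
  · obtain rfl | ⟨k, rfl⟩ : i = 1 ∨ ∃ k, i = k + 2 := by
      rcases i with _ | _ | k <;> simp_all
    · obtain ⟨hU, hV⟩ := h.two_step (by omega)
      exact ⟨Finset.inter_eq_left.1 hU, Finset.inter_eq_left.1 hV⟩
    · obtain ⟨hU, -, hV⟩ := h.even_step (k + 1) (by omega) (by omega) (Nat.even_iff.2 (by omega))
      exact ⟨hU ▸ Finset.inter_subset_right, Finset.inter_eq_left.1 hV⟩

theorem subset_of_even (h : IsBicliqueChain E l U V) {i : ℕ} (hi : 1 ≤ i) (hil : i + 1 ≤ l)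
    (hpar : i % 2 = 0) : V i ⊆ V (i + 1) ∧ U (i + 1) ⊆ U i := by
  by_cases hil' : i + 2 ≤ l
  · obtain ⟨hU, hV, -⟩ := h.even_step i hi hil' (Nat.even_iff.2 hpar)
    exact ⟨Finset.inter_eq_left.1 hV, hU ▸ Finset.inter_subset_left⟩
  · obtain ⟨k, rfl⟩ : ∃ k, i = k + 2 := ⟨i - 2, by omega⟩
    obtain ⟨hV, -, hU⟩ := h.odd_step (k + 1) (by omega) (by omega) (Nat.odd_iff.2 (by omega))
    exact ⟨hV ▸ Finset.inter_subset_right, Finset.inter_eq_left.1 hU⟩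

theorem disjoint_rows (h : IsBicliqueChain E l U V) {i : ℕ} (hi : 1 ≤ i) (hil : i + 2 ≤ l)
    (hpar : i % 2 = 1) : Disjoint (U i) (U (i + 2)) := by
  obtain ⟨y, hy⟩ := h.cols_nonempty (i + 1) (by omega) (by omega)
  have hyi := (h.subset_of_odd hi (by omega) hpar).2 hy
  have hyi' := (h.subset_of_even (i := i + 1) (by omega) hil (by omega)).1 hy
  exact Finset.disjoint_left.2 fun x hx hx' =>
    Finset.disjoint_left.1 (h.edges_disjoint i (i + 2) hi le_rfl hil)
      (Finset.mk_mem_product hx hyi) (Finset.mk_mem_product hx' hyi')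

theorem disjoint_cols (h : IsBicliqueChain E l U V) {i : ℕ} (hi : 1 ≤ i) (hil : i + 2 ≤ l)
    (hpar : i % 2 = 0) : Disjoint (V i) (V (i + 2)) := by
  obtain ⟨x, hx⟩ := h.rows_nonempty (i + 1) (by omega) (by omega)
  have hxi := (h.subset_of_even hi (by omega) hpar).2 hx
  have hxi' := (h.subset_of_odd (i := i + 1) (by omega) hil (by omega)).1 hx
  exact Finset.disjoint_left.2 fun y hy hy' =>
    Finset.disjoint_left.1 (h.edges_disjoint i (i + 2) hi le_rfl hil)
      (Finset.mk_mem_product hxi hy) (Finset.mk_mem_product hxi' hy')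

theorem exists_rowType (h : IsBicliqueChain E l U V) (x : Fin m) :
    ∃ t, (1 ≤ t ∧ t ≤ l) ∧ ∀ i, 1 ≤ i → i ≤ l → (x ∈ U i ↔ TypeMem 0 t i) := by
  refine exists_type_of_chain (fun i hi hil hpar => (h.subset_of_odd hi hil hpar).1)
    (fun i hi hil hpar => (h.subset_of_even hi hil hpar).2)
    (fun i hi hil hpar => h.disjoint_rows hi hil hpar)
    (fun i j k hi hij hjk hk x hx hx' =>
      h.rows_consecutive i j k hi hij hjk hk (Finset.mem_inter.2 ⟨hx, hx'⟩))
    (fun x => ?_) x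
  have := h.rows_cover.symm ▸ Finset.mem_univ x
  simpa [and_assoc] using this

theorem exists_colType (h : IsBicliqueChain E l U V) (y : Fin n) :
    ∃ t, (1 ≤ t ∧ t ≤ l) ∧ ∀ i, 1 ≤ i → i ≤ l → (y ∈ V i ↔ TypeMem 1 t i) := by
  refine exists_type_of_chain (fun i hi hil hpar => (h.subset_of_even hi hil (by omega)).1)
    (fun i hi hil hpar => (h.subset_of_odd hi hil (by omega)).2)
    (fun i hi hil hpar => h.disjoint_cols hi hil (by omega))
    (fun i j k hi hij hjk hk y hy hy' =>
      h.cols_consecutive i j k hi hij hjk hk (Finset.mem_inter.2 ⟨hy, hy'⟩))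
    (fun y => ?_) y
  have := h.cols_cover.symm ▸ Finset.mem_univ y
  simpa [and_assoc] using this

theorem exists_isStaircase (h : IsBicliqueChain E l U V) :
    ∃ τ σ, IsStaircase (fun x y => (x, y) ∈ E) l 0 τ σ := by
  choose τ hτ mem_U using h.exists_rowType
  choose σ hσ mem_V using h.exists_colType
  refine ⟨τ, σ, hτ, hσ, fun x y => ?_, fun k hk hkl hpar => ?_, fun k hk hkl hpar => ?_⟩
  · have mem_E : (x, y) ∈ E ↔ ∃ i, 1 ≤ i ∧ i ≤ l ∧ x ∈ U i ∧ y ∈ V i := by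
      rw [← h.edges]
      simp [and_assoc]
    rw [mem_E]
    constructor
    · rintro ⟨i, hi, hil, hx, hy⟩
      rw [mem_U x i hi hil] at hx
      rw [mem_V y i hi hil] at hy
      omega
    · intro hxy
      obtain ⟨h1, h2⟩ := hτ x
      exact ⟨τ x, h1, h2, (mem_U x _ h1 h2).2 (Or.inl rfl), (mem_V y _ h1 h2).2 (by omega)⟩
  · obtain ⟨x, hx⟩ := h.rows_nonempty k hk hkl
    have := (mem_U x k hk hkl).1 hx
    exact ⟨x, by omega⟩
  · obtain ⟨y, hy⟩ := h.cols_nonempty k hk hkl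
    have := (mem_V y k hk hkl).1 hy
    exact ⟨y, by omega⟩

end IsBicliqueChain

theorem HasChainStructure.exists_isStaircase {m n : ℕ} {E : Finset (Fin m × Fin n)}
    (h : HasChainStructure E) :
    ∃ l e τ σ, IsStaircase (fun x y => (x, y) ∈ E) l e τ σ := by
  obtain ⟨l, U, V, h | h⟩ := h
  · obtain ⟨τ, σ, hE⟩ := h.exists_isStaircase
    exact ⟨l, 0, τ, σ, hE⟩
  · obtain ⟨τ, σ, hE⟩ := h.exists_isStaircase
    exact ⟨l, 1, σ, τ, by simpa using hE.transpose⟩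

end Staircase

/-! ### The rank criterion -/

section Criterion

variable {K ι κ : Type*} [Field K]

/-- `(x, y)` belongs to the corner of `(i, j)`: it is sampled, its row is sampled in column `j` and
its column is sampled in row `i`. -/
def InCorner (E : ι → κ → Prop) (i : ι) (j : κ) (x : ι) (y : κ) : Prop :=
  E x j ∧ E i y ∧ E x y

open Classical in
/-- The entries of `Z` in the corner of `(i, j)`. They are padded by zeros, so that the corners of
all positions have the format of `Z`. -/
noncomputable def corner (E : ι → κ → Prop) (Z : Matrix ι κ K) (i : ι) (j : κ) : Matrix ι κ K :=
  of fun x y => if InCorner E i j x y then Z x y else 0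

/-- If `(i, j)` is not sampled and has a nonempty corner, then the rank of this corner is the full
rank of `Z`. -/
def CornerFull [Fintype κ] (E : ι → κ → Prop) (Z : Matrix ι κ K) (i : ι) (j : κ) : Prop :=
  ¬ E i j → (∃ x y, InCorner E i j x y) → (corner E Z i j).rank = Z.rank

variable {E : ι → κ → Prop} {l e : ℕ} {τ : ι → ℕ} {σ : κ → ℕ} {Z : Matrix ι κ K} {i : ι} {j : κ}

theorem inCorner_transpose {x : ι} {y : κ} :
    InCorner (fun y x => E x y) j i y x ↔ InCorner E i j x y :=
  and_left_comm

open Classical in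
theorem corner_transpose : corner (fun y x => E x y) Zᵀ j i = (corner E Z i j)ᵀ := by
  ext y x
  exact if_congr inCorner_transpose rfl rfl

theorem cornerFull_transpose [Fintype ι] [Fintype κ] :
    CornerFull (fun y x => E x y) Zᵀ j i ↔ CornerFull E Z i j := by
  simp only [CornerFull, corner_transpose, rank_transpose, inCorner_transpose]
  rw [exists_comm]

namespace IsStaircase

theorem corner_eq_block (h : IsStaircase E l e τ σ) {k : ℕ} (hk : (k + e) % 2 = 1)
    (hi : τ i = k + 1 ∨ τ i = k + 2) (hj : σ j = k ∨ σ j + 1 = k) :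
    corner E Z i j = block (fun x => τ x = k) (fun y => σ y = k + 1) Z := by
  have inCorner_iff : ∀ x y, InCorner E i j x y ↔ τ x = k ∧ σ y = k + 1 := by
    intro x y
    rw [InCorner, h.iff, h.iff, h.iff]
    omega
  ext x y
  simp [corner, block, inCorner_iff]

theorem rank_block_eq [Fintype κ] (h : IsStaircase E l e τ σ)
    (hfull : ∀ i j, CornerFull E Z i j) {k : ℕ} (hk : (k + e) % 2 = 1)
    (hi : τ i = k + 1 ∨ τ i = k + 2) (hj : σ j ≤ k) :
    (block (fun x => τ x = k) (fun y => σ y = k + 1) Z).rank = Z.rank := by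
  have hτi := h.row_mem i
  have hσj := h.col_mem j
  obtain ⟨j', hj'⟩ : ∃ j', σ j' = k ∨ σ j' + 1 = k := by
    by_cases hk1 : k = 1
    · exact ⟨j, by omega⟩
    · obtain ⟨j', hj'⟩ := h.col_surj (k - 1) (by omega) (by omega) (by omega)
      exact ⟨j', by omega⟩
  obtain ⟨x, hx⟩ := h.row_surj k (by omega) (by omega) hk
  obtain ⟨y, hy⟩ := h.col_surj (k + 1) (by omega) (by omega) (by omega)
  rw [← h.corner_eq_block hk hi hj']
  refine hfull i j' (by rw [h.iff]; omega) ⟨x, y, ?_⟩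
  rw [InCorner, h.iff, h.iff, h.iff]
  omega

variable [Finite ι] [Fintype κ]

theorem cornerFull_of_rigid_of_le [Nontrivial Kˣ] (h : IsStaircase E l e τ σ) (hrig : Rigid E Z)
    (hij : σ j ≤ τ i) : CornerFull E Z i j := by
  rintro hE ⟨x, y, hxj, hiy, hxy⟩
  obtain ⟨k, hk, hjk, hki⟩ : ∃ k, (k + e) % 2 = 1 ∧ (σ j = k ∨ σ j + 1 = k) ∧ k < τ i := by
    rw [h.iff] at hE
    by_cases hpar : (σ j + e) % 2 = 1
    · exact ⟨σ j, hpar, by omega, by omega⟩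
    · exact ⟨σ j + 1, by omega, by omega, by omega⟩
  rw [h.iff] at hxj hiy hxy
  rw [h.corner_eq_block hk (by omega) hjk]
  refine hrig.rank_block_eq (L := fun x => τ x ≤ k) (C := fun y => σ y ≤ k) ?_ ?_
    ⟨x, by omega⟩ ⟨i, by omega⟩ ⟨j, by omega⟩ ⟨y, by omega⟩
  · intro x' y' hx' hy' hE'
    rw [h.iff] at hE'
    omega
  · intro x' y' hx' hy' hE'
    rw [h.iff] at hE'
    omega

theorem cornerFull_of_rigid [Nontrivial Kˣ] (h : IsStaircase E l e τ σ)
    (hrig : Rigid E Z) (i : ι) (j : κ) : CornerFull E Z i j := by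
  rcases le_total (σ j) (τ i) with hij | hij
  · exact h.cornerFull_of_rigid_of_le hrig hij
  · cases nonempty_fintype ι
    exact cornerFull_transpose.1 (h.transpose.cornerFull_of_rigid_of_le hrig.transpose hij)

-- Full blocks propagate: an unsampled position `(i, j)` is completed from the block next to row
-- `i`, whose rows have types closer to that of column `j`.
theorem apply_eq_of_le (h : IsStaircase E l e τ σ) (hfull : ∀ i j, CornerFull E Z i j)
    {M : Matrix ι κ K} (hM : ∀ i j, E i j → M i j = Z i j) (hr : M.rank ≤ Z.rank) {i : ι} {j : κ}
    (hij : σ j ≤ τ i) : M i j = Z i j := by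
  induction hd : τ i - σ j using Nat.strong_induction_on generalizing i with
  | h d ih =>
    by_cases hE : E i j
    · exact hM i j hE
    rw [h.iff] at hE
    obtain ⟨k, hk, hi, hj⟩ : ∃ k, (k + e) % 2 = 1 ∧ (τ i = k + 1 ∨ τ i = k + 2) ∧ σ j ≤ k := by
      by_cases hpar : (τ i + e) % 2 = 1
      · exact ⟨τ i - 2, by omega, by omega, by omega⟩
      · exact ⟨τ i - 1, by omega, by omega, by omega⟩
    symm
    refine apply_eq_of_rank_block hr (h.rank_block_eq hfull hk hi hj) ?_ ?_ ?_
    · exact fun x y hx hy => (hM x y (by rw [h.iff]; omega)).symm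
    · exact fun y hy => (hM i y (by rw [h.iff]; omega)).symm
    · exact fun x hx => (ih (τ x - σ j) (by omega) (by omega) rfl).symm

theorem rigid_of_cornerFull (h : IsStaircase E l e τ σ)
    (hfull : ∀ i j, CornerFull E Z i j) : Rigid E Z := by
  intro M hM hr
  ext i j
  rcases le_total (σ j) (τ i) with hij | hij
  · exact h.apply_eq_of_le hfull hM hr hij
  · cases nonempty_fintype ι
    exact h.transpose.apply_eq_of_le (M := Mᵀ) (Z := Zᵀ)
      (fun j i => cornerFull_transpose.2 (hfull i j))
      (fun j i => hM i j) (by rwa [rank_transpose, rank_transpose]) hij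

theorem rigid_iff [Nontrivial Kˣ] (h : IsStaircase E l e τ σ) :
    Rigid E Z ↔ ∀ i j, CornerFull E Z i j :=
  ⟨h.cornerFull_of_rigid, h.rigid_of_cornerFull⟩

end IsStaircase

theorem existsUnique_isSolution_iff {m n : ℕ} (E : Finset (Fin m × Fin n))
    (Z : Matrix (Fin m) (Fin n) ℝ) :
    (∃! M, IsSolution E (sample E Z) Z.rank M) ↔ Rigid (fun x y => (x, y) ∈ E) Z := by
  have sample_eq_iff (M) : sample E M = sample E Z ↔ ∀ i j, (i, j) ∈ E → M i j = Z i j :=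
    ⟨fun h i j hij => congrFun h ⟨(i, j), hij⟩, fun h => funext fun e => h _ _ e.2⟩
  constructor
  · rintro ⟨M₀, -, hM₀⟩ M hM hr
    rw [hM₀ M ⟨(sample_eq_iff M).2 hM, hr⟩, hM₀ Z ⟨rfl, le_rfl⟩]
  · exact fun h => ⟨Z, ⟨rfl, le_rfl⟩, fun M hM => h M ((sample_eq_iff M).1 hM.1) hM.2⟩

end Criterion

/-! ### Total correctness with time bounds -/

/-- Started in memory `s`, the program `c` halts after at most `T` steps in a memory
satisfying `Q`. -/
def Runs (c : Prog) (s : State) (T : ℕ) (Q : State → Prop) : Prop :=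
  ∃ t s', Exec c s t s' ∧ t ≤ T ∧ Q s'

/-- `for x = 0, …, (variable b) - 1 do c`. -/
def forLoop (x b : ℕ) (c : Prog) : Prog :=
  .seq (.setVar x (.lit 0))
    (.while (.ilt (.var x) (.var b)) (.seq c (.setVar x (.add (.var x) (.lit 1)))))

namespace Runs

variable {c d : Prog} {s : State} {T T' : ℕ} {Q Q' : State → Prop}

theorem mono (h : Runs c s T Q) (hT : T ≤ T') (hQ : ∀ s', Q s' → Q' s') : Runs c s T' Q' := by
  obtain ⟨t, s', hexec, ht, hs'⟩ := h
  exact ⟨t, s', hexec, ht.trans hT, hQ _ hs'⟩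

theorem skip (h : Q s) : Runs .skip s 1 Q := ⟨1, s, .skip s, le_rfl, h⟩

theorem setVar {x : ℕ} {a : IExp} (h : Q (s.setVar x (a.eval s))) :
    Runs (.setVar x a) s (a.cost + 1) Q := ⟨_, _, .setVar x a s, le_rfl, h⟩

theorem setReal {k : ℕ} {i j : IExp} {a : RExp}
    (h : Q (s.setReal k (i.eval s) (j.eval s) (a.eval s))) :
    Runs (.setReal k i j a) s (i.cost + j.cost + a.cost + 1) Q :=
  ⟨_, _, .setReal k i j a s, le_rfl, h⟩

theorem seq (h : Runs c s T fun s' => Runs d s' T' Q) : Runs (.seq c d) s (T + T') Q := by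
  obtain ⟨t, s', hc, ht, t', s'', hd, ht', hs''⟩ := h
  exact ⟨_, _, .seq hc hd, Nat.add_le_add ht ht', hs''⟩

theorem ite {b : BExp} (h : b.Holds s → Runs c s T Q) (h' : ¬ b.Holds s → Runs d s T Q) :
    Runs (.ite b c d) s (b.cost + T) Q := by
  by_cases hb : b.Holds s
  · obtain ⟨t, s', hc, ht, hs'⟩ := h hb
    exact ⟨_, _, .ite_true hb hc, Nat.add_le_add_left ht _, hs'⟩
  · obtain ⟨t, s', hd, ht, hs'⟩ := h' hb
    exact ⟨_, _, .ite_false hb hd, Nat.add_le_add_left ht _, hs'⟩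

theorem while_ilt {x b N : ℕ} {I : ℕ → State → Prop} (hb : ∀ k s, I k s → s.ivar b = N)
    (hx : ∀ k s, I k s → s.ivar x = k)
    (hc : ∀ k < N, ∀ s, I k s → Runs c s T (I (k + 1))) {k : ℕ} (hk : k ≤ N) (hs : I k s) :
    Runs (.while (.ilt (.var x) (.var b)) c) s ((N - k) * (T + 3) + 3) (I N) := by
  induction hd : N - k generalizing k s with
  | zero =>
    obtain rfl : k = N := by omega
    refine ⟨_, s, .while_false ?_, ?_, hs⟩
    · simp [BExp.Holds, IExp.eval, hx k s hs, hb k s hs]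
    · simp [BExp.cost, IExp.cost]
  | succ d ih =>
    obtain ⟨t, s', hexec, ht, hs'⟩ := hc k (by omega) s hs
    obtain ⟨t', s'', hexec', ht', hs''⟩ := ih (k := k + 1) (by omega) hs' (by omega)
    refine ⟨_, s'', .while_true ?_ hexec hexec', ?_, hs''⟩
    · simp only [BExp.Holds, IExp.eval, hx k s hs, hb k s hs]
      omega
    · simp only [BExp.cost, IExp.cost, Nat.succ_mul]
      omega

theorem forLoop {x b N : ℕ} {I : ℕ → State → Prop} (hb : ∀ k s, I k s → s.ivar b = N)
    (hx : ∀ k s v, I k s → I k (s.setVar x v))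
    (hc : ∀ k < N, ∀ s, I k s → s.ivar x = k → Runs c s T fun s' => I (k + 1) s' ∧ s'.ivar x = k)
    (h0 : I 0 s) : Runs (forLoop x b c) s (N * (T + 7) + 5) (I N) := by
  have while_runs : Runs
      (.while (.ilt (.var x) (.var b)) (.seq c (.setVar x (.add (.var x) (.lit 1)))))
      (s.setVar x 0) ((N - 0) * (T + 4 + 3) + 3) fun s' => I N s' ∧ s'.ivar x = N := by
    refine while_ilt (I := fun k s => I k s ∧ s.ivar x = k) (fun k s hs => hb k s hs.1)
      (fun k s hs => hs.2) (fun k hk s hs => seq ?_) (Nat.zero_le N)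
      ⟨hx 0 s 0 h0, by simp [State.setVar]⟩
    refine (hc k hk s hs.1 hs.2).mono le_rfl fun s' hs' => setVar ⟨hx _ _ _ hs'.1, ?_⟩
    simp [State.setVar, IExp.eval, hs'.2]
  have time_le : 1 + 1 + ((N - 0) * (T + 4 + 3) + 3) ≤ N * (T + 7) + 5 := by
    simp only [Nat.sub_zero, Nat.add_assoc, Nat.reduceAdd]
    omega
  exact (seq (setVar while_runs)).mono time_le fun s' hs' => hs'.1

end Runs

/-- The memory `s'` differs from `s` at most in the integer variables `vs` and the real
arrays `ks`. -/
structure Frame (vs ks : Finset ℕ) (s s' : State) : Prop where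
  ivar : ∀ v, v ∉ vs → s'.ivar v = s.ivar v
  iarr : s'.iarr = s.iarr
  rarr : ∀ k, k ∉ ks → s'.rarr k = s.rarr k

namespace Frame

variable {vs vs' ks ks' : Finset ℕ} {s s' s'' : State}

theorem refl (vs ks : Finset ℕ) (s : State) : Frame vs ks s s :=
  ⟨fun _ _ => rfl, rfl, fun _ _ => rfl⟩

theorem trans (h : Frame vs ks s s') (h' : Frame vs ks s' s'') : Frame vs ks s s'' :=
  ⟨fun v hv => (h'.ivar v hv).trans (h.ivar v hv), h'.iarr.trans h.iarr,
    fun k hk => (h'.rarr k hk).trans (h.rarr k hk)⟩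

theorem mono (h : Frame vs ks s s') (hv : vs ⊆ vs') (hk : ks ⊆ ks') : Frame vs' ks' s s' :=
  ⟨fun v hv' => h.ivar v fun h' => hv' (hv h'), h.iarr,
    fun k hk' => h.rarr k fun h' => hk' (hk h')⟩

theorem setVar {x : ℕ} (hx : x ∈ vs) (a : ℕ) : Frame vs ks s (s.setVar x a) where
  ivar _ hv := Function.update_of_ne (ne_of_mem_of_not_mem hx hv).symm _ _
  iarr := rfl
  rarr _ _ := rfl

theorem setReal {k : ℕ} (hk : k ∈ ks) (i j : ℕ) (a : ℝ) : Frame vs ks s (s.setReal k i j a) where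
  ivar _ _ := rfl
  iarr := rfl
  rarr k' hk' := by
    have ne : k' ≠ k := fun h => hk' (h ▸ hk)
    simp [State.setReal, ne]

end Frame

/-! ### Loops through the positions of a matrix -/

namespace Reg

-- The integer variables of the program. The first three are the ones filled by `input`.
abbrev rows : ℕ := 0
abbrev cols : ℕ := 1
abbrev targetRank : ℕ := 2
abbrev posRow : ℕ := 3
abbrev posCol : ℕ := 4
abbrev x : ℕ := 5
abbrev y : ℕ := 6
abbrev pivotRow : ℕ := 7
abbrev pivotCol : ℕ := 8
abbrev rankCount : ℕ := 9
abbrev cornerFlag : ℕ := 10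
abbrev badFlag : ℕ := 11

-- The arrays of the program. Number `0` holds the sampled entries in the real memory and the
-- adjacency matrix in the integer memory.
abbrev data : ℕ := 0
abbrev work : ℕ := 1
abbrev copy : ℕ := 2

end Reg

open Reg

/-- The memory `s` holds the format `m × n`. -/
structure StoresFormat (m n : ℕ) (s : State) : Prop where
  rows : s.ivar rows = m
  cols : s.ivar cols = n

theorem StoresFormat.of_frame {m n : ℕ} {vs ks : Finset ℕ} {s s' : State}
    (h : StoresFormat m n s) (hF : Frame vs ks s s') (hvs : Disjoint vs {Reg.rows, Reg.cols}) :
    StoresFormat m n s' := by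
  rw [Finset.disjoint_right] at hvs
  exact ⟨(hF.ivar _ (hvs (by simp))).trans h.rows, (hF.ivar _ (hvs (by simp))).trans h.cols⟩

/-- A loop through the positions of a matrix, row by row. -/
def matLoop (x y : ℕ) (c : Prog) : Prog := forLoop x rows (forLoop y cols c)

/-- Sets the variable `v` to `1` if the program `c` does so at some position of a matrix, and to `0`
otherwise. -/
def anyLoop (v x y : ℕ) (c : Prog) : Prog := .seq (.setVar v (.lit 0)) (matLoop x y c)

/-- A time bound for a loop with a body of time at most `T` through a matrix with at most `N` rows
and columns. It is evaluated at natural numbers and at polynomials. -/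
def loopTime {R : Type*} [CommSemiring R] (N T : R) : R := N * (N * (T + 7) + 12) + 5

/-- The positions that precede `(a, b)` in the row by row order. -/
def visited {m n : ℕ} (a b : ℕ) : Set (Fin m × Fin n) := {q | q.1 < a ∨ q.1 = a ∧ q.2 < b}

section Visited

variable {m n : ℕ}

theorem visited_zero_zero : visited 0 0 = (∅ : Set (Fin m × Fin n)) := by
  simp [visited]

theorem visited_row_end (a : ℕ) : visited a n = (visited (a + 1) 0 : Set (Fin m × Fin n)) := by
  ext q
  simp [visited, Nat.le_iff_lt_or_eq]

theorem visited_end : visited m 0 = (Set.univ : Set (Fin m × Fin n)) := by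
  simp [visited]

theorem visited_succ (i : Fin m) (j : Fin n) :
    visited i (j + 1) = insert (i, j) (visited i j) := by
  ext ⟨x, y⟩
  simp only [visited, Set.mem_ofPred_eq, Set.mem_insert_iff, Prod.mk.injEq, Fin.ext_iff]
  omega

end Visited

/-- The upper left `m × n` part of an array. -/
def toMat (m n : ℕ) (f : ℕ → ℕ → ℝ) : Matrix (Fin m) (Fin n) ℝ := of fun i j => f i j

namespace Runs

variable {m n T x y : ℕ} {c : Prog} {vs ks : Finset ℕ} {s₀ : State}

theorem matLoop {I : Set (Fin m × Fin n) → State → Prop} (hs₀ : StoresFormat m n s₀)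
    (hnodup : [rows, cols, x, y].Nodup) (hvs : Disjoint vs {rows, cols, x, y})
    (hI : ∀ S s s', Frame {x, y} ∅ s s' → I S s → I S s')
    (hc : ∀ (i : Fin m) (j : Fin n) s, Frame ({x, y} ∪ vs) ks s₀ s → I (visited i j) s →
      s.ivar x = i → s.ivar y = j →
      Runs c s T fun s' => Frame vs ks s s' ∧ I (insert (i, j) (visited i j)) s')
    (h0 : I ∅ s₀) :
    Runs (matLoop x y c) s₀ (loopTime (m + n) T)
      fun s' => Frame ({x, y} ∪ vs) ks s₀ s' ∧ I Set.univ s' := by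
  simp only [List.nodup_cons, List.mem_cons, List.not_mem_nil, or_false, not_or] at hnodup
  simp only [Finset.disjoint_insert_right, Finset.disjoint_singleton_right] at hvs
  have format_of_frame : ∀ {s}, Frame ({x, y} ∪ vs) ks s₀ s → StoresFormat m n s := fun hF =>
    hs₀.of_frame hF (by simp [hvs, hnodup])
  have time_le : m * (n * (T + 7) + 5 + 7) + 5 ≤ loopTime (m + n) T := by
    rw [loopTime, Nat.add_assoc (n * (T + 7))]
    gcongr <;> omega
  rw [← visited_end]
  refine (forLoop (I := fun a s => Frame ({x, y} ∪ vs) ks s₀ s ∧ I (visited a 0) s)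
    (fun a s hs => (format_of_frame hs.1).rows)
    (fun a s v hs => ⟨hs.1.trans (.setVar (by simp) v), hI _ _ _ (.setVar (by simp) v) hs.2⟩)
    (fun a ha s hs hsx => ?_) ⟨.refl _ _ _, by rwa [visited_zero_zero]⟩).mono time_le fun _ h => h
  refine (forLoop (I := fun b s => (Frame ({x, y} ∪ vs) ks s₀ s ∧ I (visited a b) s) ∧ s.ivar x = a)
    (fun b s hs => (format_of_frame hs.1.1).cols)
    (fun b s v hs => ⟨⟨hs.1.1.trans (.setVar (by simp) v), hI _ _ _ (.setVar (by simp) v) hs.1.2⟩,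
      (Function.update_of_ne (by tauto) _ _).trans hs.2⟩)
    (fun b hb s hs hsy => ?_) ⟨hs, hsx⟩).mono le_rfl fun s' hs' => by rwa [← visited_row_end]
  refine (hc ⟨a, ha⟩ ⟨b, hb⟩ s hs.1.1 hs.1.2 hs.2 hsy).mono le_rfl fun s' ⟨hF, hs'⟩ => ?_
  rw [← visited_succ] at hs'
  exact ⟨⟨⟨hs.1.1.trans (hF.mono Finset.subset_union_right subset_rfl), hs'⟩,
    (hF.ivar x (by tauto)).trans hs.2⟩, (hF.ivar y (by tauto)).trans hsy⟩

theorem storeLoop {k : ℕ} {F : Matrix (Fin m) (Fin n) ℝ} (hs₀ : StoresFormat m n s₀)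
    (hnodup : [rows, cols, x, y].Nodup)
    (hc : ∀ (i : Fin m) (j : Fin n) s, Frame {x, y} {k} s₀ s → s.ivar x = i → s.ivar y = j →
      Runs c s T (· = s.setReal k i j (F i j))) :
    Runs (LRMC.matLoop x y c) s₀ (loopTime (m + n) T)
      fun s' => Frame {x, y} {k} s₀ s' ∧ toMat m n (s'.rarr k) = F := by
  refine (matLoop (vs := ∅) (ks := {k}) (I := fun S s => ∀ q ∈ S, s.rarr k q.1 q.2 = F q.1 q.2)
    hs₀ hnodup (Finset.disjoint_empty_left _) ?_ ?_ (by simp)).mono le_rfl ?_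
  · intro S s s' hF hs q hq
    rw [hF.rarr k (Finset.notMem_empty k), hs q hq]
  · intro i j s hF hs hx hy
    refine (hc i j s (by simpa using hF) hx hy).mono le_rfl ?_
    rintro _ rfl
    refine ⟨.setReal (by simp) _ _ _, ?_⟩
    rintro ⟨i', j'⟩ hq
    by_cases hij : i' = i ∧ j' = j
    · simp [State.setReal, hij]
    · simpa [State.setReal, ← Fin.ext_iff, hij] using hs (i', j') (by simpa [hij] using hq)
  · exact fun s' ⟨hF, hs'⟩ => ⟨by simpa using hF, by ext i j; exact hs' (i, j) trivial⟩

open Classical in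
theorem anyLoop {v : ℕ} {P : Fin m → Fin n → Prop} (hs₀ : StoresFormat m n s₀)
    (hnodup : [rows, cols, x, y].Nodup) (hv : v ∈ vs) (hvs : Disjoint vs {rows, cols, x, y})
    (hc : ∀ (i : Fin m) (j : Fin n) s, Frame ({x, y} ∪ vs) ks s₀ s → s.ivar x = i → s.ivar y = j →
      Runs c s T fun s' => Frame vs ks s s' ∧ s'.ivar v = if P i j then 1 else s.ivar v) :
    Runs (anyLoop v x y c) s₀ (2 + loopTime (m + n) T)
      fun s' => Frame ({x, y} ∪ vs) ks s₀ s' ∧ s'.ivar v = if ∃ i j, P i j then 1 else 0 := by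
  have hF₁ : Frame ({x, y} ∪ vs) ks s₀ (s₀.setVar v 0) := .setVar (by simp [hv]) 0
  rw [Finset.disjoint_left] at hvs
  refine seq (setVar ((matLoop (ks := ks)
    (I := fun S s => s.ivar v = if ∃ i j, (i, j) ∈ S ∧ P i j then 1 else 0)
    (hs₀.of_frame (.setVar hv 0 : Frame vs ks _ _) ?_) hnodup (Finset.disjoint_left.2 hvs)
    ?_ ?_ ?_).mono le_rfl ?_))
  · refine Finset.disjoint_left.2 fun w hw hw' => hvs hw ?_
    simp only [Finset.mem_insert, Finset.mem_singleton] at hw' ⊢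
    tauto
  · intro S s s' hF hs
    have v_notMem : v ∉ ({x, y} : Finset ℕ) := fun h => hvs hv <| by
      simp only [Finset.mem_insert, Finset.mem_singleton] at h ⊢
      tauto
    rw [hF.ivar v v_notMem, hs]
  · intro i j s hF hs hx hy
    refine (hc i j s (hF₁.trans hF) hx hy).mono le_rfl fun s' ⟨hF', hs'⟩ => ⟨hF', ?_⟩
    rw [hs', hs, ← ite_or]
    simp only [Set.mem_insert_iff, Prod.mk.injEq, or_and_right, exists_or, and_assoc,
      exists_and_left, exists_eq_left]
  · simp [State.setVar]
  · exact fun s' ⟨hF, hs'⟩ => ⟨hF₁.trans hF, by simpa using hs'⟩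

end Runs

/-! ### Computing the rank of the working array -/

section Deflation

variable {K : Type*} [Field K] {m n : ℕ} {B : Matrix (Fin m) (Fin n) K} {p : Fin m} {q : Fin n}

theorem deflate_eq_self (h : B p q = 0) : deflate B p q = B := by
  ext x y
  simp [deflate, h]

theorem deflate_eq_zero_on_insert_visited (hB : ∀ a ∈ visited p q, B a.1 a.2 = 0) :
    ∀ a ∈ insert (p, q) (visited p q), deflate B p q a.1 a.2 = 0 := by
  rintro ⟨i, j⟩ ha
  by_cases h : B p q = 0
  · rw [deflate_eq_self h]
    obtain ⟨rfl, rfl⟩ | ha := by simpa using ha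
    exacts [h, hB _ ha]
  · obtain hi | rfl : i < p ∨ i = p := by
      simp only [visited, Set.mem_insert_iff, Set.mem_ofPred_eq, Prod.mk.injEq] at ha
      omega
    · simp [deflate, hB (i, j) (.inl hi), hB (i, q) (.inl hi)]
    · exact deflate_apply_pivotRow B h j

end Deflation

/-- The real expression that reads the array `k` at the position stored in the variables `x` and
`y`. -/
def entry (k x y : ℕ) : RExp := .get k (.var x) (.var y)

/-- Deflates the working array at the position stored in `pivotRow` and `pivotCol`. -/
def deflateProg : Prog :=
  .seq (matLoop x y (.setReal copy (.var x) (.var y) (entry work x y)))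
    (matLoop x y (.setReal work (.var x) (.var y)
      (.sub (entry copy x y)
        (.div (.mul (entry copy x pivotCol) (entry copy pivotRow y))
          (entry copy pivotRow pivotCol)))))

/-- Counts and deflates the pivot at the position stored in `pivotRow` and `pivotCol`, unless it is
zero. -/
def pivotStep : Prog :=
  .ite (.not (.req (entry work pivotRow pivotCol) .zero))
    (.seq (.setVar rankCount (.add (.var rankCount) (.lit 1))) deflateProg) .skip

/-- Stores the rank of the working array in `rankCount`, and destroys that array. -/
def rankProg : Prog :=
  .seq (.setVar rankCount (.lit 0)) (matLoop pivotRow pivotCol pivotStep)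

/-- A time bound for `deflateProg`. -/
def deflateTime {R : Type*} [CommSemiring R] (N : R) : R := loopTime N 6 + loopTime N 18

/-- A time bound for `rankProg`. -/
def rankTime {R : Type*} [CommSemiring R] (N : R) : R := 2 + loopTime N (10 + deflateTime N)

section Rank

variable {m n : ℕ} {s : State}

theorem runs_deflateProg (hs : StoresFormat m n s) {p : Fin m} {q : Fin n}
    (hp : s.ivar pivotRow = p) (hq : s.ivar pivotCol = q) :
    Runs deflateProg s (deflateTime (m + n)) fun s' => Frame {x, y} {work, copy} s s' ∧
      toMat m n (s'.rarr work) = deflate (toMat m n (s.rarr work)) p q := by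
  refine .seq ((Runs.storeLoop (k := copy) (F := toMat m n (s.rarr work)) hs (by decide)
    fun i j s' hF hx hy => .setReal ?_).mono le_rfl fun s₁ ⟨hF₁, hcopy⟩ => ?_)
  · simp [IExp.eval, RExp.eval, entry, toMat, hx, hy, hF.rarr work (by decide)]
  have copy_apply (i : Fin m) (j : Fin n) : s₁.rarr copy i j = s.rarr work i j :=
    congrFun (congrFun hcopy i) j
  refine (Runs.storeLoop (k := work) (F := deflate (toMat m n (s.rarr work)) p q)
    (hs.of_frame hF₁ (by decide)) (by decide) fun i j s' hF hx hy => .setReal ?_).mono le_rfl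
    fun s₂ ⟨hF₂, hwork⟩ => ⟨?_, hwork⟩
  · have hp' := (hF.ivar pivotRow (by decide)).trans ((hF₁.ivar _ (by decide)).trans hp)
    have hq' := (hF.ivar pivotCol (by decide)).trans ((hF₁.ivar _ (by decide)).trans hq)
    simp [IExp.eval, RExp.eval, entry, toMat, deflate, hx, hy, hp', hq', hF.rarr copy (by decide),
      copy_apply]
  · exact (hF₁.mono subset_rfl (by decide)).trans (hF₂.mono subset_rfl (by decide))

theorem runs_pivotStep (hs : StoresFormat m n s) {p : Fin m} {q : Fin n}
    (hp : s.ivar pivotRow = p) (hq : s.ivar pivotCol = q) :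
    Runs pivotStep s (10 + deflateTime (m + n)) fun s' =>
      Frame {x, y, rankCount} {work, copy} s s' ∧
      toMat m n (s'.rarr work) = deflate (toMat m n (s.rarr work)) p q ∧
      s'.ivar rankCount + (toMat m n (s'.rarr work)).rank =
        s.ivar rankCount + (toMat m n (s.rarr work)).rank := by
  have pivot_eq : (entry work pivotRow pivotCol).eval s = toMat m n (s.rarr work) p q := by
    simp [entry, RExp.eval, IExp.eval, toMat, hp, hq]
  refine (Runs.ite (T := 4 + deflateTime (m + n)) (fun pivot_ne => ?_) fun pivot_eq_zero => ?_).mono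
    (by simp only [BExp.cost, RExp.cost, IExp.cost, entry]; omega) fun _ h => h
  · have rank_eq := rank_deflate (toMat m n (s.rarr work)) (ne_of_eq_of_ne pivot_eq.symm pivot_ne)
    have hF : Frame {x, y, rankCount} {work, copy} s (s.setVar rankCount (s.ivar rankCount + 1)) :=
      .setVar (by decide) _
    refine .seq (.setVar ((runs_deflateProg (hs.of_frame hF (by decide)) hp hq).mono le_rfl
      fun s' ⟨hF', hwork⟩ => ⟨hF.trans (hF'.mono (by decide) subset_rfl), hwork, ?_⟩))
    have count_eq : s'.ivar rankCount = s.ivar rankCount + 1 := hF'.ivar _ (by decide)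
    rw [hwork, count_eq, ← rank_eq]
    exact add_right_comm _ _ _
  · have pivot_eq_zero := not_not.1 pivot_eq_zero
    have deflate_eq := deflate_eq_self (pivot_eq.symm.trans pivot_eq_zero)
    exact (Runs.skip ⟨.refl _ _ _, deflate_eq.symm, rfl⟩).mono (by omega) fun _ h => h

theorem runs_rankProg (hs : StoresFormat m n s) :
    Runs rankProg s (rankTime (m + n)) fun s' =>
      Frame {x, y, pivotRow, pivotCol, rankCount} {work, copy} s s' ∧
      s'.ivar rankCount = (toMat m n (s.rarr work)).rank := by
  have hF₁ : Frame {x, y, pivotRow, pivotCol, rankCount} {work, copy} s (s.setVar rankCount 0) :=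
    .setVar (by decide) 0
  refine .seq (.setVar ((Runs.matLoop (vs := {x, y, rankCount}) (ks := {work, copy})
    (I := fun S s' => (∀ a ∈ S, toMat m n (s'.rarr work) a.1 a.2 = 0) ∧
      s'.ivar rankCount + (toMat m n (s'.rarr work)).rank = (toMat m n (s.rarr work)).rank)
    (hs.of_frame hF₁ (by decide)) (by decide) (by decide) ?_ ?_ ?_).mono le_rfl ?_))
  · intro S s₁ s₂ hF hs₁
    rwa [hF.ivar rankCount (by decide), hF.rarr work (by decide)]
  · intro p q s₁ hF ⟨hzero, hrank⟩ hp hq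
    refine (runs_pivotStep ((hs.of_frame hF₁ (by decide)).of_frame hF (by decide)) hp hq).mono
      le_rfl fun s₂ ⟨hF', hwork, hrank'⟩ => ⟨hF', ?_, hrank'.trans hrank⟩
    rw [hwork]
    exact deflate_eq_zero_on_insert_visited hzero
  · simp [State.setVar]
  · intro s' ⟨hF, hzero, hrank⟩
    have work_eq_zero : toMat m n (s'.rarr work) = 0 := by
      ext i j
      exact hzero (i, j) trivial
    rw [work_eq_zero, rank_zero, add_zero] at hrank
    exact ⟨hF₁.trans (hF.mono (by decide) subset_rfl), hrank⟩

end Rank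

/-! ### The decision procedure -/

/-- The memory `s` holds the completion problem with sampled positions `E` and target matrix `Z`. -/
structure StoresInstance {m n : ℕ} (E : Fin m → Fin n → Prop) (Z : Matrix (Fin m) (Fin n) ℝ)
    (s : State) : Prop extends StoresFormat m n s where
  targetRank : s.ivar targetRank = Z.rank
  adjacency : ∀ (i : Fin m) (j : Fin n), s.iarr data i j = 1 ↔ E i j
  samples : ∀ (i : Fin m) (j : Fin n), E i j → s.rarr data i j = Z i j

theorem storesInstance_input {m n : ℕ} (E : Finset (Fin m × Fin n))
    (Z : Matrix (Fin m) (Fin n) ℝ) :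
    StoresInstance (fun i j => (i, j) ∈ E) Z (input E (sample E Z) Z.rank) where
  rows := rfl
  cols := rfl
  targetRank := rfl
  adjacency i j := by simp [input]
  samples i j h := by simp [input, sample, h]

/-- Tests whether the position stored in `x` and `y` lies in the corner at the position stored in
`posRow` and `posCol`. -/
def inCornerTest : BExp :=
  .and (.ieq (.get data (.var x) (.var posCol)) (.lit 1))
    (.and (.ieq (.get data (.var posRow) (.var y)) (.lit 1))
      (.ieq (.get data (.var x) (.var y)) (.lit 1)))

/-- Copies the corner at the position stored in `posRow` and `posCol` to the working array, and
records in `cornerFlag` whether it contains a position. -/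
def cornerProg : Prog :=
  .seq
    (matLoop x y (.ite inCornerTest (.setReal work (.var x) (.var y) (entry data x y))
      (.setReal work (.var x) (.var y) .zero)))
    (anyLoop cornerFlag x y (.ite inCornerTest (.setVar cornerFlag (.lit 1)) .skip))

/-- Raises `badFlag` if the corner at the position stored in `posRow` and `posCol` is not full. -/
def positionProg : Prog :=
  .ite (.ieq (.get data (.var posRow) (.var posCol)) (.lit 1)) .skip
    (.seq cornerProg (.seq rankProg
      (.ite
        (.and (.ieq (.var cornerFlag) (.lit 1)) (.not (.ieq (.var rankCount) (.var targetRank))))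
        (.setVar badFlag (.lit 1)) .skip)))

/-- Decides whether the corners at all positions are full. The answer goes to the variable `0`. -/
def decideProg : Prog :=
  .seq (anyLoop badFlag posRow posCol positionProg) (.setVar 0 (.sub (.lit 1) (.var badFlag)))

/-- A time bound for `cornerProg`. -/
def cornerTime {R : Type*} [CommSemiring R] (N : R) : R := loopTime N 23 + (2 + loopTime N 19)

/-- A time bound for `positionProg`. -/
def positionTime {R : Type*} [CommSemiring R] (N : R) : R := 5 + (cornerTime N + (rankTime N + 10))

/-- A time bound for `decideProg`. -/
def decideTime {R : Type*} [CommSemiring R] (N : R) : R := 2 + loopTime N (positionTime N) + 4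

theorem eval_decideTime (N : ℕ) :
    (decideTime (Polynomial.X : Polynomial ℕ)).eval N = decideTime N := by
  simp [decideTime, positionTime, cornerTime, rankTime, deflateTime, loopTime]

section Decide

variable {m n : ℕ} {E : Fin m → Fin n → Prop} {Z : Matrix (Fin m) (Fin n) ℝ} {s s' : State}

theorem StoresInstance.of_frame {vs ks : Finset ℕ} (h : StoresInstance E Z s)
    (hF : Frame vs ks s s') (hvs : Disjoint vs {Reg.rows, Reg.cols, Reg.targetRank})
    (hks : data ∉ ks) : StoresInstance E Z s' where
  toStoresFormat := h.toStoresFormat.of_frame hF (hvs.mono_right (by decide))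
  targetRank := (hF.ivar _ (Finset.disjoint_right.1 hvs (by decide))).trans h.targetRank
  adjacency := by simpa only [hF.iarr] using h.adjacency
  samples := by simpa only [hF.rarr _ hks] using h.samples

theorem StoresInstance.holds_inCornerTest (h : StoresInstance E Z s) {i a : Fin m} {j b : Fin n}
    (hi : s.ivar posRow = i) (hj : s.ivar posCol = j) (ha : s.ivar x = a) (hb : s.ivar y = b) :
    inCornerTest.Holds s ↔ InCorner E i j a b := by
  simp [inCornerTest, InCorner, BExp.Holds, IExp.eval, hi, hj, ha, hb, h.adjacency]

open Classical in
theorem runs_cornerProg (hs : StoresInstance E Z s) {i : Fin m} {j : Fin n}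
    (hi : s.ivar posRow = i) (hj : s.ivar posCol = j) :
    Runs cornerProg s (cornerTime (m + n)) fun s' => Frame {x, y, cornerFlag} {work} s s' ∧
      toMat m n (s'.rarr work) = corner E Z i j ∧
      s'.ivar cornerFlag = if ∃ a b, InCorner E i j a b then 1 else 0 := by
  have test_iff {s'} {vs : Finset ℕ} (hF : Frame vs {work} s s')
      (hvs : Disjoint vs {rows, cols, targetRank, posRow, posCol}) {a : Fin m} {b : Fin n}
      (ha : s'.ivar x = a) (hb : s'.ivar y = b) :
      inCornerTest.Holds s' ↔ InCorner E i j a b :=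
    (hs.of_frame hF (hvs.mono_right (by decide)) (by decide)).holds_inCornerTest
      ((hF.ivar _ (Finset.disjoint_right.1 hvs (by decide))).trans hi)
      ((hF.ivar _ (Finset.disjoint_right.1 hvs (by decide))).trans hj) ha hb
  refine .seq ((Runs.storeLoop (k := work) (F := corner E Z i j) hs.toStoresFormat (by decide)
    fun a b s' hF ha hb => .ite (T := 6) (fun h => ?_) fun h => ?_).mono le_rfl
    fun s₁ ⟨hF₁, hwork⟩ => ?_)
  · rw [test_iff hF (by decide) ha hb] at h
    refine .setReal ?_
    simp [corner, h, entry, IExp.eval, RExp.eval, ha, hb, hF.rarr data (by decide),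
      hs.samples a b h.2.2]
  · rw [test_iff hF (by decide) ha hb] at h
    refine (Runs.setReal ?_).mono (by decide) fun _ h => h
    simp [corner, h, IExp.eval, RExp.eval, ha, hb]
  refine (Runs.anyLoop (vs := {cornerFlag}) (ks := ∅) (P := InCorner E i j)
    (hs.toStoresFormat.of_frame hF₁ (by decide)) (by decide) (by decide) (by decide)
    fun a b s' hF ha hb => .ite (T := 2) (fun h => ?_) fun h => ?_).mono le_rfl
    fun s₂ ⟨hF₂, hflag⟩ =>
      ⟨(hF₁.mono (by decide) subset_rfl).trans (hF₂.mono (by decide) (by simp)),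
        (congrArg _ (hF₂.rarr _ (by simp))).trans hwork, hflag⟩
  all_goals
    have hF' : Frame {x, y, cornerFlag} {work} s s' :=
      (hF₁.mono (by decide) subset_rfl).trans (hF.mono (by decide) (by simp))
    rw [test_iff hF' (by decide) ha hb] at h
  · exact .setVar ⟨.setVar (by simp) _, by simp [State.setVar, IExp.eval, h]⟩
  · exact (Runs.skip ⟨.refl _ _ _, by simp [h]⟩).mono (by decide) fun _ h => h

open Classical in
theorem runs_positionProg (hs : StoresInstance E Z s) {i : Fin m} {j : Fin n}
    (hi : s.ivar posRow = i) (hj : s.ivar posCol = j) :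
    Runs positionProg s (positionTime (m + n)) fun s' =>
      Frame {x, y, pivotRow, pivotCol, rankCount, cornerFlag, badFlag} {work, copy} s s' ∧
      s'.ivar badFlag = if CornerFull E Z i j then s.ivar badFlag else 1 := by
  have sampled_iff :
      (BExp.ieq (.get data (.var posRow) (.var posCol)) (.lit 1)).Holds s ↔ E i j := by
    simp [BExp.Holds, IExp.eval, hi, hj, hs.adjacency]
  refine .ite (fun h => ?_) fun h => ?_
  · rw [sampled_iff] at h
    exact (Runs.skip ⟨.refl _ _ _, by simp [CornerFull, h]⟩).mono (by omega) fun _ h => h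
  rw [sampled_iff] at h
  refine .seq ((runs_cornerProg hs hi hj).mono le_rfl fun s₁ ⟨hF₁, hwork, hflag⟩ => ?_)
  have hs₁ := hs.of_frame hF₁ (by decide) (by decide)
  refine .seq ((runs_rankProg hs₁.toStoresFormat).mono le_rfl fun s₂ ⟨hF₂, hrank⟩ => ?_)
  have hs₂ := hs₁.of_frame hF₂ (by decide) (by decide)
  have hF : Frame {x, y, pivotRow, pivotCol, rankCount, cornerFlag, badFlag} {work, copy} s s₂ :=
    (hF₁.mono (by decide) (by decide)).trans (hF₂.mono (by decide) subset_rfl)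
  have bad_iff : (BExp.and (.ieq (.var cornerFlag) (.lit 1))
      (.not (.ieq (.var rankCount) (.var targetRank)))).Holds s₂ ↔ ¬ CornerFull E Z i j := by
    rw [hwork] at hrank
    simp [BExp.Holds, IExp.eval, CornerFull, h, hrank, hs₂.targetRank,
      hF₂.ivar cornerFlag (by decide), hflag]
  refine .ite (T := 2) (fun hbad => ?_) fun hbad => ?_
  · rw [bad_iff] at hbad
    exact .setVar ⟨hF.trans (.setVar (by decide) _), by simp [State.setVar, IExp.eval, hbad]⟩
  · rw [bad_iff] at hbad
    refine (Runs.skip ⟨hF, ?_⟩).mono (by decide) fun _ h => h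
    rw [if_pos (not_not.1 hbad), hF₂.ivar _ (by decide), hF₁.ivar _ (by decide)]

open Classical in
theorem runs_decideProg (hs : StoresInstance E Z s) :
    Runs decideProg s (decideTime (m + n))
      fun s' => s'.ivar 0 = if ∀ i j, CornerFull E Z i j then 1 else 0 := by
  refine .seq ((Runs.anyLoop (vs := {x, y, pivotRow, pivotCol, rankCount, cornerFlag, badFlag})
    (ks := {work, copy}) (P := fun i j => ¬ CornerFull E Z i j) hs.toStoresFormat (by decide)
    (by decide) (by decide) fun i j s' hF hi hj =>
      (runs_positionProg (hs.of_frame hF (by decide) (by decide)) hi hj).mono le_rfl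
        fun s'' ⟨hF', h⟩ => ⟨hF', by rw [h]; split_ifs <;> rfl⟩).mono le_rfl
    fun s' ⟨_, hbad⟩ => .setVar ?_)
  simp only [← not_forall] at hbad
  by_cases hfull : ∀ i j, CornerFull E Z i j <;>
    simp [State.setVar, IExp.eval, hbad, hfull]

end Decide

end LRMC

theorem mainTheorem10 :
    ∃ (c : LRMC.Prog) (p : Polynomial ℕ),
      ∀ (m n : ℕ) (E : Finset (Fin m × Fin n)) (Z : Matrix (Fin m) (Fin n) ℝ),
        LRMC.HasChainStructure E →
        ∃ (t : ℕ) (s : LRMC.State),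
          LRMC.Exec c (LRMC.input E (LRMC.sample E Z) Z.rank) t s ∧
          t ≤ p.eval (m + n) ∧
          (s.ivar 0 = 0 ∨ s.ivar 0 = 1) ∧
          (s.ivar 0 = 1 ↔ ∃! M : Matrix (Fin m) (Fin n) ℝ,
            LRMC.IsSolution E (LRMC.sample E Z) Z.rank M) := by
  open LRMC in
  refine ⟨decideProg, decideTime .X, fun m n E Z hE => ?_⟩
  obtain ⟨l, e, τ, σ, staircase⟩ := hE.exists_isStaircase
  have : Nontrivial ℝˣ := ⟨1, -1, units_ne_neg_self 1⟩
  obtain ⟨t, s, hexec, ht, hs⟩ := runs_decideProg (storesInstance_input E Z)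
  refine ⟨t, s, hexec, by rwa [eval_decideTime], ?_, ?_⟩
  · rw [hs]
    split_ifs <;> simp
  · rw [hs, existsUnique_isSolution_iff, staircase.rigid_iff]
    simp
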